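/- Let $(M,g)$ be a smooth 6-dimensional Riemannian manifold with Levi-Civita connection $\nabla$, curvature tensor $R(X,Y)Z=[\nabla_X,\nabla_Y]Z-\nabla_{[X,Y]}Z$, $R(X,Y,Z,W)=g(R(X,Y)Z,W)$, Ricci tensor $\rho(X,Y)=\operatorname{Tr}(Z\mapsto R(Z,X)Y)$ and scalar curvature $\tau=\operatorname{Tr}_g\rho$. All components are taken with respect to an orthonormal frame $\{e_i\}$, with $R_{ijkl}=R(e_i,e_j,e_k,e_l)$, and repeated indices are summed from $1$ to $6$. Put $\|R\|^2=R_{abcd}R_{abcd}$ and $$\tilde R_{ij}=R_{iabc}R_{jabc},\quad \check R_{ij}=R_{iuvj}R_{abcu}R_{abcv},\quad \hat R_{ij}=R_{ibcd}R_{jbuv}R_{cduv},\quad \mathring R_{ij}=R_{ibcd}R_{jucv}R_{budv},$$ $$\hat R=R_{abcd}R_{abuv}R_{cduv},\qquad \mathring R=R_{abcd}R_{aucv}R_{budv}.$$ The manifold is called Einstein if $\rho=\frac{\tau}{6}g$, and super-Einstein if it is Einstein, $\|R\|^2$ is constant on $M$ and $\tilde R_{ij}=\frac{\|R\|^2}{6}g_{ij}$.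 (a) If $M$ is Einstein, then at every point of $M$ and for all $i,j$ $$4\tau\tilde R_{ij}+12\check R_{ij}+12\hat R_{ij}-24\mathring R_{ij}=\bigl(\tau\|R\|^2-4\mathring R+2\hat R\bigr)g_{ij}.$$ (b) If $M$ is super-Einstein, then at every point of $M$ and for all $i,j$ $$2\mathring R_{ij}-\hat R_{ij}=\tfrac16\bigl(2\mathring R-\hat R\bigr)g_{ij}.$$ -/

import Mathlib

open scoped Manifold ContDiff BigOperators
open Bundle

noncomputable section

namespace RiemCurv

/-- Smooth Riemannian metrics on a smooth `n`-manifold (without boundary) `M`. -/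
abbrev Metric (n : ℕ) (M : Type*) [TopologicalSpace M]
    [ChartedSpace (EuclideanSpace ℝ (Fin n)) M] [IsManifold (𝓡 n) ∞ M] :=
  ContMDiffRiemannianMetric (𝓡 n) ∞ (EuclideanSpace ℝ (Fin n))
    (fun x : M => TangentSpace (𝓡 n) x)

/-! ### Local coordinates -/

section Local

variable {n : ℕ} {M : Type*} [TopologicalSpace M]
  [ChartedSpace (EuclideanSpace ℝ (Fin n)) M] [IsManifold (𝓡 n) ∞ M]

/-- The partial derivative `∂f/∂yⁱ` of a function on `ℝⁿ`. -/
def partialDeriv (i : Fin n) (f : EuclideanSpace ℝ (Fin n) → ℝ)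
    (y : EuclideanSpace ℝ (Fin n)) : ℝ :=
  fderiv ℝ f y (EuclideanSpace.single i (1 : ℝ))

/-- The coordinate vector field `∂ᵢ` of the chart around `x₀`, at the point with coordinates
`y`. -/
def coordVec (x₀ : M) (y : EuclideanSpace ℝ (Fin n)) (i : Fin n) :
    TangentSpace (𝓡 n) ((extChartAt (𝓡 n) x₀).symm y) :=
  mfderiv 𝓘(ℝ, EuclideanSpace ℝ (Fin n)) (𝓡 n) (extChartAt (𝓡 n) x₀).symm y
    (EuclideanSpace.single i (1 : ℝ))

/-- The matrix `g_{ij} = g(∂ᵢ, ∂ⱼ)` of the metric in the chart around `x₀`. -/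
def metricCoeff (g : Metric n M) (x₀ : M) (y : EuclideanSpace ℝ (Fin n)) :
    Matrix (Fin n) (Fin n) ℝ :=
  Matrix.of fun i j =>
    g.inner ((extChartAt (𝓡 n) x₀).symm y) (coordVec x₀ y i) (coordVec x₀ y j)

/-- The Christoffel symbols of the Levi-Civita connection, `∇_{∂ᵢ} ∂ⱼ = ∑ₖ Γᵏᵢⱼ ∂ₖ`:
`Γᵏᵢⱼ = ½ ∑ₗ gᵏˡ (∂ᵢ gⱼₗ + ∂ⱼ gᵢₗ - ∂ₗ gᵢⱼ)`. -/
def christoffel (g : Metric n M) (x₀ : M) (k i j : Fin n)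
    (y : EuclideanSpace ℝ (Fin n)) : ℝ :=
  (1 / 2) * ∑ l, (metricCoeff g x₀ y)⁻¹ k l *
    (partialDeriv i (fun z => metricCoeff g x₀ z j l) y
      + partialDeriv j (fun z => metricCoeff g x₀ z i l) y
      - partialDeriv l (fun z => metricCoeff g x₀ z i j) y)

/-- The components `R(∂ᵢ, ∂ⱼ) ∂ₖ = ∑ₗ Rˡᵢⱼₖ ∂ₗ` of the curvature
`R(X, Y) Z = ∇_X ∇_Y Z - ∇_Y ∇_X Z - ∇_{[X, Y]} Z`:
`Rˡᵢⱼₖ = ∂ᵢ Γˡⱼₖ - ∂ⱼ Γˡᵢₖ + ∑ₘ (Γˡᵢₘ Γᵐⱼₖ - Γˡⱼₘ Γᵐᵢₖ)`. -/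
def curvCoeff (g : Metric n M) (x₀ : M) (l i j k : Fin n)
    (y : EuclideanSpace ℝ (Fin n)) : ℝ :=
  partialDeriv i (christoffel g x₀ l j k) y - partialDeriv j (christoffel g x₀ l i k) y
    + ∑ m, (christoffel g x₀ l i m y * christoffel g x₀ m j k y
        - christoffel g x₀ l j m y * christoffel g x₀ m i k y)

/-! ### The curvature tensor on tangent vectors -/

/-- The differential at `p` of the chart around `p`. -/
def chartDeriv (n : ℕ) {M : Type*} [TopologicalSpace M]
    [ChartedSpace (EuclideanSpace ℝ (Fin n)) M] (p : M) :
    TangentSpace (𝓡 n) p →L[ℝ] EuclideanSpace ℝ (Fin n) :=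
  mfderiv (𝓡 n) 𝓘(ℝ, EuclideanSpace ℝ (Fin n)) (extChartAt (𝓡 n) p) p

/-- The curvature operator `R(X, Y) Z` at `p`, for tangent vectors `X, Y, Z` at `p`. It does not
depend on the coordinates (it is a tensor); it is computed in
the chart around `p`, where `(dφₚ)⁻¹(eₗ) = ∂ₗ`. -/
def curv (g : Metric n M) (p : M) (X Y Z : TangentSpace (𝓡 n) p) : TangentSpace (𝓡 n) p :=
  ∑ i, ∑ j, ∑ k, ∑ l,
    (chartDeriv n p X i * chartDeriv n p Y j * chartDeriv n p Z k *
        curvCoeff g p l i j k (extChartAt (𝓡 n) p p)) •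
      (chartDeriv n p).inverse (EuclideanSpace.single l (1 : ℝ))

/-- `R(X, Y, Z, W) = g(R(X, Y) Z, W)`. -/
def curv4 (g : Metric n M) (p : M) (X Y Z W : TangentSpace (𝓡 n) p) : ℝ :=
  g.inner p (curv g p X Y Z) W

/-- The linear map `Z ↦ R(Z, X) Y`. -/
def ricciEndo (g : Metric n M) (p : M) (X Y : TangentSpace (𝓡 n) p) :
    TangentSpace (𝓡 n) p →ₗ[ℝ] TangentSpace (𝓡 n) p where
  toFun Z := curv g p Z X Y
  map_add' Z W := by
    simp only [curv, map_add, PiLp.add_apply, add_mul, add_smul, Finset.sum_add_distrib]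
  map_smul' c Z := by
    simp only [curv, map_smul, PiLp.smul_apply, smul_eq_mul, RingHom.id_apply, Finset.smul_sum,
      smul_smul, mul_assoc]

/-- The Ricci tensor `ρ(X, Y) = Tr(Z ↦ R(Z, X) Y)`. -/
def ricci (g : Metric n M) (p : M) (X Y : TangentSpace (𝓡 n) p) : ℝ :=
  LinearMap.trace ℝ (TangentSpace (𝓡 n) p) (ricciEndo g p X Y)

/-! ### Orthonormal frames and components -/

/-- `e₁, …, eₙ` is an orthonormal basis of the tangent space at `p`, where `n = dim M`. -/
def IsOrthonormalFrame (g : Metric n M) (p : M) (e : Fin n → TangentSpace (𝓡 n) p) : Prop :=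
  ∀ i j, g.inner p (e i) (e j) = if i = j then 1 else 0

/-- The scalar curvature `τ = ∑ₐ ρ(eₐ, eₐ)`, computed in an orthonormal frame. -/
def scalarCurv (g : Metric n M) (p : M) (e : Fin n → TangentSpace (𝓡 n) p) : ℝ :=
  ∑ a, ricci g p (e a) (e a)

/-- The components `R_{abcd} = R(e_a, e_b, e_c, e_d)` of the curvature tensor. -/
def comp (g : Metric n M) (p : M) (e : Fin n → TangentSpace (𝓡 n) p) (a b c d : Fin n) : ℝ :=
  curv4 g p (e a) (e b) (e c) (e d)

end Local

/-! ### Contractions of the components of the curvature tensor in an orthonormal frame -/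

section Contractions

variable {n : ℕ} (R : Fin n → Fin n → Fin n → Fin n → ℝ)

/-- `‖R‖² = R_{abcd} R_{abcd}`. -/
def normSq : ℝ := ∑ a, ∑ b, ∑ c, ∑ d, R a b c d * R a b c d

/-- `R̃_{ij} = R_{iabc} R_{jabc}`. -/
def tildeR (i j : Fin n) : ℝ := ∑ a, ∑ b, ∑ c, R i a b c * R j a b c

/-- `Ř_{ij} = R_{iuvj} R_{abcu} R_{abcv}`. -/
def checkR (i j : Fin n) : ℝ :=
  ∑ u, ∑ v, ∑ a, ∑ b, ∑ c, R i u v j * R a b c u * R a b c v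

/-- `R̂_{ij} = R_{ibcd} R_{jbuv} R_{cduv}`. -/
def hatR (i j : Fin n) : ℝ :=
  ∑ b, ∑ c, ∑ d, ∑ u, ∑ v, R i b c d * R j b u v * R c d u v

/-- `R̊_{ij} = R_{ibcd} R_{jucv} R_{budv}`. -/
def ringR (i j : Fin n) : ℝ :=
  ∑ b, ∑ c, ∑ d, ∑ u, ∑ v, R i b c d * R j u c v * R b u d v

/-- The scalar `R̂ = R_{abcd} R_{abuv} R_{cduv}`. -/
def hatScalar : ℝ :=
  ∑ a, ∑ b, ∑ c, ∑ d, ∑ u, ∑ v, R a b c d * R a b u v * R c d u v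

/-- The scalar `R̊ = R_{abcd} R_{aucv} R_{budv}`. -/
def ringScalar : ℝ :=
  ∑ a, ∑ b, ∑ c, ∑ d, ∑ u, ∑ v, R a b c d * R a u c v * R b u d v

end Contractions

/-! ### Einstein and super-Einstein metrics -/

section Einstein

variable {n : ℕ} {M : Type*} [TopologicalSpace M]
  [ChartedSpace (EuclideanSpace ℝ (Fin n)) M] [IsManifold (𝓡 n) ∞ M]

/-- Einstein: `ρ = (τ / n) g` at every point (`τ` is the same in all orthonormal frames). -/
def IsEinstein (g : Metric n M) : Prop :=
  ∀ (p : M) (e : Fin n → TangentSpace (𝓡 n) p), IsOrthonormalFrame g p e →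
    ∀ X Y : TangentSpace (𝓡 n) p, ricci g p X Y = scalarCurv g p e / n * g.inner p X Y

/-- Super-Einstein: Einstein, `‖R‖²` is constant on `M`, and
`∑ R(X, e_a, e_b, e_c) R(Y, e_a, e_b, e_c) = (‖R‖² / n) g(X, Y)`. -/
def IsSuperEinstein (g : Metric n M) : Prop :=
  IsEinstein g ∧ ∃ N : ℝ, ∀ (p : M) (e : Fin n → TangentSpace (𝓡 n) p),
    IsOrthonormalFrame g p e →
      normSq (comp g p e) = N ∧
      ∀ X Y : TangentSpace (𝓡 n) p,
        ∑ a, ∑ b, ∑ c, curv4 g p X (e a) (e b) (e c) * curv4 g p Y (e a) (e b) (e c)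
          = N / n * g.inner p X Y

end Einstein

end RiemCurv

end

/-! The identity is purely algebraic and special to dimension six: it expresses the vanishing of the
cubic Lovelock tensor. Here it is derived from a Cayley–Hamilton phenomenon for skew matrices.

If `A`, `B` are skew 6 × 6 matrices, the characteristic polynomial of `A * B` is the square of a
cubic, and that cubic already annihilates `A * B` (`skew_mul_skew_cube`). The reason is the Pfaffian
adjugate, quadratic in its argument, which inverts a skew matrix up to a multiple of its Pfaffian.
Writing the coefficients of the cubic through traces makes the relation cubic in `A` and in `B`,
built only from products and traces, so it can be polarized.

Write the curvature as a tensor `∑ Aₛ ⊗ Bₛ` in Λ² ⊗ Λ² and insert three copies of it into the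
polarized relation. Each resulting term is a contraction of three curvature tensors. Adjacent
factors with the same label collapse to the Ricci tensor, which is `k • 1` in the Einstein case;
only four genuine contractions survive (`contracted_identity`). The pair symmetry and the first
Bianchi identity turn these into `tildeR`, `checkR`, `hatR` and `ringR`, giving
`IsAlgCurv.einstein_identity` with `k = τ / 6`.

Geometry enters only through the algebraic symmetries of the curvature, obtained from the coordinate
formula `curvLower_eq` and carried to frames by multilinearity, and through the Ricci trace in an
orthonormal frame. In the super-Einstein case `tildeR` and `checkR` are multiples of the metric and
cancel against `τ‖R‖²`. -/

namespace RiemCurv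

/-! ### The Cayley–Hamilton theorem for a product of two skew-symmetric `6 × 6` matrices -/

section Pfaffian

open Matrix

/-- The polarization of the Pfaffian of the `4 × 4` principal submatrix with indices
`p, q, r, t`. -/
def pf4 (A B : Matrix (Fin 6) (Fin 6) ℝ) (p q r t : Fin 6) : ℝ :=
  A p q * B r t + B p q * A r t - A p r * B q t - B p r * A q t + A p t * B q r + B p t * A q r

/-- The polarization of the Pfaffian adjugate of skew-symmetric `6 × 6` matrices. -/
def pfAdj (A B : Matrix (Fin 6) (Fin 6) ℝ) : Matrix (Fin 6) (Fin 6) ℝ :=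
  !![0, -pf4 A B 2 3 4 5, pf4 A B 1 3 4 5, -pf4 A B 1 2 4 5, pf4 A B 1 2 3 5, -pf4 A B 1 2 3 4;
     pf4 A B 2 3 4 5, 0, -pf4 A B 0 3 4 5, pf4 A B 0 2 4 5, -pf4 A B 0 2 3 5, pf4 A B 0 2 3 4;
     -pf4 A B 1 3 4 5, pf4 A B 0 3 4 5, 0, -pf4 A B 0 1 4 5, pf4 A B 0 1 3 5, -pf4 A B 0 1 3 4;
     pf4 A B 1 2 4 5, -pf4 A B 0 2 4 5, pf4 A B 0 1 4 5, 0, -pf4 A B 0 1 2 5, pf4 A B 0 1 2 4;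
     -pf4 A B 1 2 3 5, pf4 A B 0 2 3 5, -pf4 A B 0 1 3 5, pf4 A B 0 1 2 5, 0, -pf4 A B 0 1 2 3;
     pf4 A B 1 2 3 4, -pf4 A B 0 2 3 4, pf4 A B 0 1 3 4, -pf4 A B 0 1 2 4, pf4 A B 0 1 2 3, 0]

/-- The skew-symmetric matrix with prescribed entries above the diagonal. -/
def skewOf (a : Fin 6 → Fin 6 → ℝ) : Matrix (Fin 6) (Fin 6) ℝ :=
  !![0, a 0 1, a 0 2, a 0 3, a 0 4, a 0 5;
     -a 0 1, 0, a 1 2, a 1 3, a 1 4, a 1 5;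
     -a 0 2, -a 1 2, 0, a 2 3, a 2 4, a 2 5;
     -a 0 3, -a 1 3, -a 2 3, 0, a 3 4, a 3 5;
     -a 0 4, -a 1 4, -a 2 4, -a 3 4, 0, a 4 5;
     -a 0 5, -a 1 5, -a 2 5, -a 3 5, -a 4 5, 0]

/-- A skew matrix has 15 free entries; in terms of them the Pfaffian identities below become
polynomial identities, checked entry by entry. -/
lemma eq_skewOf {A : Matrix (Fin 6) (Fin 6) ℝ} (hA : Aᵀ = -A) : A = skewOf A := by
  have h : ∀ i j, A i j = -A j i := fun i j => by
    have := congrFun (congrFun hA j) i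
    simpa using this
  have h0 : ∀ i, A i i = 0 := fun i => by linarith [h i i]
  ext i j
  fin_cases i <;> fin_cases j <;> first | exact h0 _ | rfl | exact h _ _

lemma pfAdj_transpose (A B : Matrix (Fin 6) (Fin 6) ℝ) : (pfAdj A B)ᵀ = -pfAdj A B := by
  ext i j
  fin_cases i <;> fin_cases j <;> simp [pfAdj]

lemma skewOf_apply (a : Fin 6 → Fin 6 → ℝ) :
    skewOf a 0 0 = 0 ∧ skewOf a 0 1 = a 0 1 ∧ skewOf a 0 2 = a 0 2 ∧ skewOf a 0 3 = a 0 3 ∧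
      skewOf a 0 4 = a 0 4 ∧ skewOf a 0 5 = a 0 5 ∧ skewOf a 1 0 = -a 0 1 ∧ skewOf a 1 1 = 0 ∧
      skewOf a 1 2 = a 1 2 ∧ skewOf a 1 3 = a 1 3 ∧ skewOf a 1 4 = a 1 4 ∧ skewOf a 1 5 = a 1 5 ∧
      skewOf a 2 0 = -a 0 2 ∧ skewOf a 2 1 = -a 1 2 ∧ skewOf a 2 2 = 0 ∧ skewOf a 2 3 = a 2 3 ∧
      skewOf a 2 4 = a 2 4 ∧ skewOf a 2 5 = a 2 5 ∧ skewOf a 3 0 = -a 0 3 ∧ skewOf a 3 1 = -a 1 3 ∧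
      skewOf a 3 2 = -a 2 3 ∧ skewOf a 3 3 = 0 ∧ skewOf a 3 4 = a 3 4 ∧ skewOf a 3 5 = a 3 5 ∧
      skewOf a 4 0 = -a 0 4 ∧ skewOf a 4 1 = -a 1 4 ∧ skewOf a 4 2 = -a 2 4 ∧ skewOf a 4 3 = -a 3 4 ∧
      skewOf a 4 4 = 0 ∧ skewOf a 4 5 = a 4 5 ∧ skewOf a 5 0 = -a 0 5 ∧ skewOf a 5 1 = -a 1 5 ∧
      skewOf a 5 2 = -a 2 5 ∧ skewOf a 5 3 = -a 3 5 ∧ skewOf a 5 4 = -a 4 5 ∧ skewOf a 5 5 = 0 := by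
  and_intros <;> rfl

lemma pfAdj_apply (A B : Matrix (Fin 6) (Fin 6) ℝ) :
    pfAdj A B 0 0 = 0 ∧ pfAdj A B 0 1 = -pf4 A B 2 3 4 5 ∧
      pfAdj A B 0 2 = pf4 A B 1 3 4 5 ∧ pfAdj A B 0 3 = -pf4 A B 1 2 4 5 ∧
      pfAdj A B 0 4 = pf4 A B 1 2 3 5 ∧ pfAdj A B 0 5 = -pf4 A B 1 2 3 4 ∧
      pfAdj A B 1 0 = pf4 A B 2 3 4 5 ∧ pfAdj A B 1 1 = 0 ∧
      pfAdj A B 1 2 = -pf4 A B 0 3 4 5 ∧ pfAdj A B 1 3 = pf4 A B 0 2 4 5 ∧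
      pfAdj A B 1 4 = -pf4 A B 0 2 3 5 ∧ pfAdj A B 1 5 = pf4 A B 0 2 3 4 ∧
      pfAdj A B 2 0 = -pf4 A B 1 3 4 5 ∧ pfAdj A B 2 1 = pf4 A B 0 3 4 5 ∧
      pfAdj A B 2 2 = 0 ∧ pfAdj A B 2 3 = -pf4 A B 0 1 4 5 ∧
      pfAdj A B 2 4 = pf4 A B 0 1 3 5 ∧ pfAdj A B 2 5 = -pf4 A B 0 1 3 4 ∧
      pfAdj A B 3 0 = pf4 A B 1 2 4 5 ∧ pfAdj A B 3 1 = -pf4 A B 0 2 4 5 ∧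
      pfAdj A B 3 2 = pf4 A B 0 1 4 5 ∧ pfAdj A B 3 3 = 0 ∧
      pfAdj A B 3 4 = -pf4 A B 0 1 2 5 ∧ pfAdj A B 3 5 = pf4 A B 0 1 2 4 ∧
      pfAdj A B 4 0 = -pf4 A B 1 2 3 5 ∧ pfAdj A B 4 1 = pf4 A B 0 2 3 5 ∧
      pfAdj A B 4 2 = -pf4 A B 0 1 3 5 ∧ pfAdj A B 4 3 = pf4 A B 0 1 2 5 ∧
      pfAdj A B 4 4 = 0 ∧ pfAdj A B 4 5 = -pf4 A B 0 1 2 3 ∧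
      pfAdj A B 5 0 = pf4 A B 1 2 3 4 ∧ pfAdj A B 5 1 = -pf4 A B 0 2 3 4 ∧
      pfAdj A B 5 2 = pf4 A B 0 1 3 4 ∧ pfAdj A B 5 3 = -pf4 A B 0 1 2 4 ∧
      pfAdj A B 5 4 = pf4 A B 0 1 2 3 ∧ pfAdj A B 5 5 = 0 := by
  and_intros <;> rfl

lemma forall_fin_six {p : Fin 6 → Prop} (h : p 0 ∧ p 1 ∧ p 2 ∧ p 3 ∧ p 4 ∧ p 5) : ∀ i, p i := by
  intro i
  fin_cases i <;> tauto

set_option maxHeartbeats 4000000 in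
lemma mul_pfAdj_skewOf (a b : Fin 6 → Fin 6 → ℝ) :
    skewOf a * pfAdj (skewOf b) (skewOf b) + (2 : ℝ) • (skewOf b * pfAdj (skewOf a) (skewOf b))
      = ((1 / 2) * (skewOf a * pfAdj (skewOf b) (skewOf b)).trace) • 1 := by
  ext i j
  simp only [Matrix.add_apply, Matrix.smul_apply, Matrix.mul_apply, Fin.sum_univ_six, Matrix.trace,
    Matrix.diag_apply, smul_eq_mul, pfAdj_apply]
  revert i j
  refine forall_fin_six ⟨?_, ?_, ?_, ?_, ?_, ?_⟩ <;>
  refine forall_fin_six ⟨?_, ?_, ?_, ?_, ?_, ?_⟩ <;>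
  · first | rw [Matrix.one_apply_eq] | rw [Matrix.one_apply_ne (by decide)]
    simp only [skewOf_apply, pfAdj_apply, pf4]
    ring

set_option maxHeartbeats 4000000 in
lemma pfAdj_pfAdj_skewOf (a b : Fin 6 → Fin 6 → ℝ) :
    pfAdj (pfAdj (skewOf a) (skewOf a)) (skewOf b)
      = (2 : ℝ) • (skewOf a * skewOf b * skewOf a)
        - (skewOf a * skewOf b).trace • skewOf a := by
  ext i j
  simp only [Matrix.sub_apply, Matrix.smul_apply, Matrix.mul_apply, Fin.sum_univ_six, Matrix.trace,
    Matrix.diag_apply, smul_eq_mul]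
  revert i j
  refine forall_fin_six ⟨?_, ?_, ?_, ?_, ?_, ?_⟩ <;>
  refine forall_fin_six ⟨?_, ?_, ?_, ?_, ?_, ?_⟩ <;>
  · simp only [skewOf_apply, pfAdj_apply, pf4]
    ring

/-- Linearization at `B`, in direction `A`, of the expansion `B * pfAdj B B = 2 Pf(B) • 1`. -/
lemma mul_pfAdj {A B : Matrix (Fin 6) (Fin 6) ℝ} (hA : Aᵀ = -A) (hB : Bᵀ = -B) :
    A * pfAdj B B + (2 : ℝ) • (B * pfAdj A B) = ((1 / 2) * (A * pfAdj B B).trace) • 1 := by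
  rw [eq_skewOf hA, eq_skewOf hB]
  exact mul_pfAdj_skewOf _ _

/-- For invertible `A` this comes from differentiating `M ↦ pfAdj M M = 2 Pf(M) M⁻¹` at `M = pfAdj A
A = 2 Pf(A) A⁻¹` in direction `B`. -/
lemma pfAdj_pfAdj {A B : Matrix (Fin 6) (Fin 6) ℝ} (hA : Aᵀ = -A) (hB : Bᵀ = -B) :
    pfAdj (pfAdj A A) B = (2 : ℝ) • (A * B * A) - (A * B).trace • A := by
  rw [eq_skewOf hA, eq_skewOf hB]
  exact pfAdj_pfAdj_skewOf _ _

lemma exists_mul_pfAdj_self {A : Matrix (Fin 6) (Fin 6) ℝ} (hA : Aᵀ = -A) :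
    ∃ μ : ℝ, A * pfAdj A A = μ • 1 ∧ pfAdj A A * A = μ • 1 := by
  have h := mul_pfAdj hA hA
  have h1 : A * pfAdj A A = ((1 / 3) * ((1 / 2) * (A * pfAdj A A).trace)) • 1 := by
    rw [mul_smul, ← h]
    module
  refine ⟨_, h1, ?_⟩
  have h2 := congrArg Matrix.transpose h1
  rwa [Matrix.transpose_mul, pfAdj_transpose, hA, neg_mul_neg, Matrix.transpose_smul,
    Matrix.transpose_one] at h2

/-- The characteristic polynomial of a product of two skew-symmetric `6 × 6` matrices is a square,
and the product is annihilated by its square root. -/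
theorem skew_mul_skew_cube {A B : Matrix (Fin 6) (Fin 6) ℝ} (hA : Aᵀ = -A) (hB : Bᵀ = -B) :
    A * B * A * B * A * B - ((1 / 2) * (A * B).trace) • (A * B * A * B)
      + ((1 / 8) * ((A * B).trace * (A * B).trace) - (1 / 4) * (A * B * A * B).trace) • (A * B)
      - ((1 / 48) * ((A * B).trace * (A * B).trace * (A * B).trace)
          - (1 / 8) * ((A * B).trace * (A * B * A * B).trace)
          + (1 / 6) * (A * B * A * B * A * B).trace) • (1 : Matrix (Fin 6) (Fin 6) ℝ) = 0 := by
  obtain ⟨ν, -, hν⟩ := exists_mul_pfAdj_self hB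
  obtain ⟨μ, -, hμ⟩ := exists_mul_pfAdj_self hA
  set P := pfAdj B B with hP
  set Q := pfAdj A A with hQ
  -- Linearizing at `A` in the direction `P` expresses `P * Q` as a quadratic polynomial in `X`.
  -- Multiplying by `X` then gives the cubic, since `P * Q * X` is scalar.
  have h1 := mul_pfAdj (pfAdj_transpose B B) hA
  rw [pfAdj_pfAdj hB hA, ← hP, ← hQ, Matrix.trace_mul_comm B A] at h1
  set l := (1 / 2) * (P * Q).trace with hl
  set X := A * B with hX
  have e2 : A * B * A * B = X * X := by rw [hX]; noncomm_ring
  have e3 : A * B * A * B * A * B = X * X * X := by rw [hX]; noncomm_ring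
  rw [e3, e2]
  have hPQ : P * Q = l • 1 + (2 * X.trace) • X - (4 : ℝ) • (X * X) := by
    rw [← h1, ← e2, hX]
    simp only [mul_sub, mul_smul_comm, smul_sub, smul_smul, mul_assoc]
    module
  -- Taking traces eliminates the unknown scalars `l` here and `μ * ν` below, so no Pfaffian remains
  -- in the final relation.
  have hl2 : l = (X * X).trace - (1 / 2) * (X.trace * X.trace) := by
    have := congrArg Matrix.trace hPQ
    simp only [Matrix.trace_sub, Matrix.trace_add, Matrix.trace_smul, Matrix.trace_one,
      Fintype.card_fin, smul_eq_mul, Nat.cast_ofNat] at this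
    linarith
  have h3 : P * Q * X = (μ * ν) • 1 := by
    have : P * Q * X = P * (Q * A) * B := by rw [hX]; noncomm_ring
    rw [this, hμ, mul_smul_comm, mul_one, smul_mul_assoc, hν, smul_smul]
  rw [hPQ] at h3
  have h4 := congrArg Matrix.trace h3
  simp only [sub_mul, add_mul, smul_mul_assoc, one_mul] at h3 h4
  simp only [Matrix.trace_sub, Matrix.trace_add, Matrix.trace_smul, Matrix.trace_one,
      Fintype.card_fin, smul_eq_mul, Nat.cast_ofNat] at h4
  have h5 : X * X * X = (1 / 4 : ℝ) • (l • X + (2 * X.trace) • (X * X) - (μ * ν) • 1) := by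
    rw [← h3]; module
  have h6 : μ * ν = (1 / 6) * (l * X.trace + 2 * X.trace * (X * X).trace
      - 4 * (X * X * X).trace) := by linarith
  rw [hl2] at h5 h6
  rw [h6] at h5
  ext i j
  have h7 := congrFun (congrFun h5 i) j
  simp only [Matrix.sub_apply, Matrix.add_apply, Matrix.smul_apply, smul_eq_mul,
    Matrix.zero_apply] at h7 ⊢
  linear_combination h7

end Pfaffian

/-! ### Polarization of the cubic relation -/

section Polarization

open Matrix

/-- Inclusion–exclusion over the subsets of `{x, y, z}`; `f` need not be symmetric. -/
lemma polarize_cubic {V W : Type*} [AddCommGroup V] [AddCommGroup W] (f : V → V → V → W)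
    (h₁ : ∀ x x' y z, f (x + x') y z = f x y z + f x' y z)
    (h₂ : ∀ x y y' z, f x (y + y') z = f x y z + f x y' z)
    (h₃ : ∀ x y z z', f x y (z + z') = f x y z + f x y z') (S : AddSubgroup V)
    (h : ∀ x ∈ S, f x x x = 0) {x y z : V} (hx : x ∈ S) (hy : y ∈ S) (hz : z ∈ S) :
    f x y z + f x z y + f y x z + f y z x + f z x y + f z y x = 0 := by
  have e := h _ (S.add_mem (S.add_mem hx hy) hz)
  have exy := h _ (S.add_mem hx hy)
  have exz := h _ (S.add_mem hx hz)
  have eyz := h _ (S.add_mem hy hz)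
  have ex := h _ hx
  have ey := h _ hy
  have ez := h _ hz
  simp only [h₁, h₂, h₃] at e exy exz eyz
  have key : f x y z + f x z y + f y x z + f y z x + f z x y + f z y x
      = 0 - 0 - 0 - 0 + 0 + 0 + 0 := by
    nth_rw 1 [← e]
    nth_rw 1 [← exy]
    nth_rw 1 [← exz]
    nth_rw 1 [← eyz]
    nth_rw 1 [← ex]
    nth_rw 1 [← ey]
    nth_rw 1 [← ez]
    abel
  simpa using key

lemma sum_symmetrize {ι W : Type*} [Fintype ι] [AddCommGroup W] (K : ι → ι → ι → W) :
    ∑ a, ∑ b, ∑ c, (K a b c + K a c b + K b a c + K b c a + K c a b + K c b a)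
      = 6 • ∑ a, ∑ b, ∑ c, K a b c := by
  have swap₂ : ∀ G : ι → ι → ι → W, ∑ a, ∑ b, ∑ c, G a c b = ∑ a, ∑ b, ∑ c, G a b c :=
    fun G => Finset.sum_congr rfl fun a _ => Finset.sum_comm
  have swap₁ : ∀ G : ι → ι → ι → W, ∑ a, ∑ b, ∑ c, G b a c = ∑ a, ∑ b, ∑ c, G a b c :=
    fun G => Finset.sum_comm
  have r₁ : ∑ a, ∑ b, ∑ c, K b c a = ∑ a, ∑ b, ∑ c, K a b c :=
    (swap₁ fun a b c => K a c b).trans (swap₂ K)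
  have r₂ : ∑ a, ∑ b, ∑ c, K c a b = ∑ a, ∑ b, ∑ c, K a b c :=
    (swap₂ fun a b c => K b a c).trans (swap₁ K)
  have r₃ : ∑ a, ∑ b, ∑ c, K c b a = ∑ a, ∑ b, ∑ c, K a b c :=
    (swap₂ fun a b c => K b c a).trans r₁
  simp only [Finset.sum_add_distrib]
  rw [swap₂ K, swap₁ K, r₁, r₂, r₃]
  abel

variable {ι : Type*} [Fintype ι]

/-- The multilinear form of the square root of the characteristic polynomial of a product of two
skew-symmetric `6 × 6` matrices. -/
noncomputable def halfCharpoly (A₁ A₂ A₃ B₁ B₂ B₃ : Matrix (Fin 6) (Fin 6) ℝ) : Matrix (Fin 6) (Fin 6) ℝ :=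
  A₁ * B₁ * A₂ * B₂ * A₃ * B₃ - ((1 / 2) * (A₁ * B₁).trace) • (A₂ * B₂ * A₃ * B₃)
    + ((1 / 8) * ((A₁ * B₁).trace * (A₂ * B₂).trace)
        - (1 / 4) * (A₁ * B₁ * A₂ * B₂).trace) • (A₃ * B₃)
    - ((1 / 48) * ((A₁ * B₁).trace * (A₂ * B₂).trace * (A₃ * B₃).trace)
        - (1 / 8) * ((A₁ * B₁).trace * (A₂ * B₂ * A₃ * B₃).trace)
        + (1 / 6) * (A₁ * B₁ * A₂ * B₂ * A₃ * B₃).trace) • (1 : Matrix (Fin 6) (Fin 6) ℝ)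

/-- The additive group of skew-symmetric matrices. -/
def skewSubgroup : AddSubgroup (Matrix (Fin 6) (Fin 6) ℝ) where
  carrier := {A | Aᵀ = -A}
  zero_mem' := by simp
  add_mem' := by
    intro A B hA hB
    simp only [Set.mem_ofPred_eq, Matrix.transpose_add] at *
    rw [hA, hB, neg_add]
  neg_mem' := by
    intro A hA
    simp only [Set.mem_ofPred_eq, Matrix.transpose_neg] at *
    rw [hA]

lemma sum_perm_halfCharpoly_right {A B₁ B₂ B₃ : Matrix (Fin 6) (Fin 6) ℝ}
    (hA : A ∈ skewSubgroup) (h₁ : B₁ ∈ skewSubgroup) (h₂ : B₂ ∈ skewSubgroup)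
    (h₃ : B₃ ∈ skewSubgroup) :
    halfCharpoly A A A B₁ B₂ B₃ + halfCharpoly A A A B₁ B₃ B₂ + halfCharpoly A A A B₂ B₁ B₃
      + halfCharpoly A A A B₂ B₃ B₁ + halfCharpoly A A A B₃ B₁ B₂
      + halfCharpoly A A A B₃ B₂ B₁ = 0 := by
  refine polarize_cubic (halfCharpoly A A A) ?_ ?_ ?_ skewSubgroup
    (fun B hB => skew_mul_skew_cube hA hB) h₁ h₂ h₃ <;>
  · intros
    simp only [halfCharpoly, mul_add, add_mul, Matrix.trace_add]
    module

/-- The sum of `halfCharpoly` over all permutations of its last three arguments. -/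
noncomputable def symHalfCharpoly (A₁ A₂ A₃ B₁ B₂ B₃ : Matrix (Fin 6) (Fin 6) ℝ) :
    Matrix (Fin 6) (Fin 6) ℝ :=
  halfCharpoly A₁ A₂ A₃ B₁ B₂ B₃ + halfCharpoly A₁ A₂ A₃ B₁ B₃ B₂
    + halfCharpoly A₁ A₂ A₃ B₂ B₁ B₃ + halfCharpoly A₁ A₂ A₃ B₂ B₃ B₁
    + halfCharpoly A₁ A₂ A₃ B₃ B₁ B₂ + halfCharpoly A₁ A₂ A₃ B₃ B₂ B₁

lemma halfCharpoly_add₁ (A₁ A₁' A₂ A₃ B₁ B₂ B₃ : Matrix (Fin 6) (Fin 6) ℝ) :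
    halfCharpoly (A₁ + A₁') A₂ A₃ B₁ B₂ B₃
      = halfCharpoly A₁ A₂ A₃ B₁ B₂ B₃ + halfCharpoly A₁' A₂ A₃ B₁ B₂ B₃ := by
  simp only [halfCharpoly, mul_add, add_mul, Matrix.trace_add]
  module

lemma halfCharpoly_add₂ (A₁ A₂ A₂' A₃ B₁ B₂ B₃ : Matrix (Fin 6) (Fin 6) ℝ) :
    halfCharpoly A₁ (A₂ + A₂') A₃ B₁ B₂ B₃
      = halfCharpoly A₁ A₂ A₃ B₁ B₂ B₃ + halfCharpoly A₁ A₂' A₃ B₁ B₂ B₃ := by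
  simp only [halfCharpoly, mul_add, add_mul, Matrix.trace_add]
  module

lemma halfCharpoly_add₃ (A₁ A₂ A₃ A₃' B₁ B₂ B₃ : Matrix (Fin 6) (Fin 6) ℝ) :
    halfCharpoly A₁ A₂ (A₃ + A₃') B₁ B₂ B₃
      = halfCharpoly A₁ A₂ A₃ B₁ B₂ B₃ + halfCharpoly A₁ A₂ A₃' B₁ B₂ B₃ := by
  simp only [halfCharpoly, mul_add, add_mul, Matrix.trace_add]
  module

/-- Full polarization has 36 terms. Under the sum, relabelling `a, b, c` in the `A`s and `B`s
together identifies them in groups of six, so permuting only the `B`s suffices. -/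
lemma sum_symHalfCharpoly {A B : ι → Matrix (Fin 6) (Fin 6) ℝ} (hA : ∀ a, (A a)ᵀ = -A a)
    (hB : ∀ a, (B a)ᵀ = -B a) :
    ∑ a, ∑ b, ∑ c, symHalfCharpoly (A a) (A b) (A c) (B a) (B b) (B c) = 0 := by
  have h6 := sum_symmetrize fun a b c => symHalfCharpoly (A a) (A b) (A c) (B a) (B b) (B c)
  have h0 : ∀ a b c, symHalfCharpoly (A a) (A b) (A c) (B a) (B b) (B c)
      + symHalfCharpoly (A a) (A c) (A b) (B a) (B c) (B b)
      + symHalfCharpoly (A b) (A a) (A c) (B b) (B a) (B c)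
      + symHalfCharpoly (A b) (A c) (A a) (B b) (B c) (B a)
      + symHalfCharpoly (A c) (A a) (A b) (B c) (B a) (B b)
      + symHalfCharpoly (A c) (A b) (A a) (B c) (B b) (B a) = 0 := by
    intro a b c
    have h := polarize_cubic (fun X Y Z => symHalfCharpoly X Y Z (B a) (B b) (B c))
      (fun _ _ _ _ => by simp only [symHalfCharpoly, halfCharpoly_add₁]; abel)
      (fun _ _ _ _ => by simp only [symHalfCharpoly, halfCharpoly_add₂]; abel)
      (fun _ _ _ _ => by simp only [symHalfCharpoly, halfCharpoly_add₃]; abel)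
      skewSubgroup (fun X hX => sum_perm_halfCharpoly_right hX (hB a) (hB b) (hB c))
      (hA a) (hA b) (hA c)
    -- `symHalfCharpoly` is symmetric in the `B`s, so permuting the `A`s alone amounts to permuting
    -- the pairs `(A, B)`.
    rw [← h]
    simp only [symHalfCharpoly]
    abel
  simp only [h0, Finset.sum_const_zero] at h6
  have h7 : (6 : ℝ) • ∑ a, ∑ b, ∑ c, symHalfCharpoly (A a) (A b) (A c) (B a) (B b) (B c) = 0 := by
    rw [h6]; module
  exact (smul_eq_zero.mp h7).resolve_left (by norm_num)

end Polarization

/-! ### Contraction with a tensor of Einstein type -/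

section Contraction

open Matrix

variable {ι : Type*} [Fintype ι] (A B : ι → Matrix (Fin 6) (Fin 6) ℝ)

/-- The contraction `∑ tr(Aₐ B_b) A_b Bₐ`. -/
def traceContr : Matrix (Fin 6) (Fin 6) ℝ :=
  ∑ a, ∑ b, (A a * B b).trace • (A b * B a)

/-- The contraction `∑ tr(Aₐ B_c) A_b Bₐ A_c B_b`. -/
def crossContr : Matrix (Fin 6) (Fin 6) ℝ :=
  ∑ a, ∑ b, ∑ c, (A a * B c).trace • (A b * B a * A c * B b)

/-- The contraction `∑ tr(Aₐ B_b) tr(A_b B_c) A_c Bₐ`. -/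
def chainContr : Matrix (Fin 6) (Fin 6) ℝ :=
  ∑ a, ∑ b, ∑ c, ((A a * B b).trace * (A b * B c).trace) • (A c * B a)

/-- The contraction `∑ Aₐ B_c A_b Bₐ A_c B_b`. -/
def cyclicContr : Matrix (Fin 6) (Fin 6) ℝ :=
  ∑ a, ∑ b, ∑ c, A a * B c * A b * B a * A c * B b

variable {A B} {k : ℝ}

/-- In five of the six orders some label occurs on neighbouring factors, and the sums collapse one
after another. Only the order of `cyclicContr` has no such neighbours. -/
lemma sum_cubic (hAB : ∑ a, A a * B a = k • 1) (hBA : ∑ a, B a * A a = k • 1) :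
    ∑ a, ∑ b, ∑ c, (A a * B a * A b * B b * A c * B c + A a * B a * A b * B c * A c * B b
      + A a * B b * A b * B a * A c * B c + A a * B b * A b * B c * A c * B a
      + A a * B c * A b * B a * A c * B b + A a * B c * A b * B b * A c * B a)
      = (5 * k ^ 3) • 1 + cyclicContr A B := by
  have hAB' : ∀ Z, ∑ a, A a * (B a * Z) = k • Z := fun Z => by
    simp only [← mul_assoc, ← Finset.sum_mul, hAB, smul_mul_assoc, one_mul]
  have hBA' : ∀ Z, ∑ a, B a * (A a * Z) = k • Z := fun Z => by
    simp only [← mul_assoc, ← Finset.sum_mul, hBA, smul_mul_assoc, one_mul]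
  have e₁ : ∑ a, ∑ b, ∑ c, A a * B a * A b * B b * A c * B c = k ^ 3 • 1 := by
    simp only [mul_assoc, ← Finset.mul_sum, hAB, hAB', mul_smul_comm, ← Finset.smul_sum, mul_one]
    module
  have e₂ : ∑ a, ∑ b, ∑ c, A a * B a * A b * B c * A c * B b = k ^ 3 • 1 := by
    simp only [mul_assoc, ← Finset.mul_sum, hAB, hAB', hBA', mul_smul_comm, ← Finset.smul_sum,
      mul_one]
    module
  have e₃ : ∑ a, ∑ b, ∑ c, A a * B b * A b * B a * A c * B c = k ^ 3 • 1 := by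
    simp only [mul_assoc, ← Finset.mul_sum, hAB, hAB', hBA', mul_smul_comm, ← Finset.smul_sum,
      mul_one]
    module
  have e₄ : ∑ a, ∑ b, ∑ c, A a * B b * A b * B c * A c * B a = k ^ 3 • 1 := by
    simp only [mul_assoc, ← Finset.mul_sum, hAB, hAB', hBA', mul_smul_comm, ← Finset.smul_sum,
      mul_one]
    module
  have e₅ : ∑ a, ∑ b, ∑ c, A a * B c * A b * B b * A c * B a = k ^ 3 • 1 := by
    have : ∀ a, ∑ b, ∑ c, A a * B c * A b * B b * A c * B a
        = ∑ c, ∑ b, A a * B c * A b * B b * A c * B a := fun a => Finset.sum_comm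
    simp only [this]
    simp only [mul_assoc, ← Finset.mul_sum, hAB, hAB', hBA', mul_smul_comm, ← Finset.smul_sum,
      mul_one]
    module
  simp only [Finset.sum_add_distrib, e₁, e₂, e₃, e₄, e₅]
  rw [cyclicContr]
  module

lemma sum_trace_smul_quadratic (hAB : ∑ a, A a * B a = k • 1) (hBA : ∑ a, B a * A a = k • 1) :
    ∑ a, ∑ b, ∑ c, ((A a * B a).trace • (A b * B b * A c * B c)
      + (A a * B a).trace • (A b * B c * A c * B b)
      + (A a * B b).trace • (A b * B a * A c * B c) + (A a * B b).trace • (A b * B c * A c * B a)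
      + (A a * B c).trace • (A b * B a * A c * B b) + (A a * B c).trace • (A b * B b * A c * B a))
      = (12 * k ^ 3) • 1 + (3 * k) • traceContr A B + crossContr A B := by
  have hAB' : ∀ Z, ∑ a, A a * (B a * Z) = k • Z := fun Z => by
    simp only [← mul_assoc, ← Finset.sum_mul, hAB, smul_mul_assoc, one_mul]
  have hBA' : ∀ Z, ∑ a, B a * (A a * Z) = k • Z := fun Z => by
    simp only [← mul_assoc, ← Finset.sum_mul, hBA, smul_mul_assoc, one_mul]
  have htr : ∑ a, (A a * B a).trace = 6 * k := by
    rw [← Matrix.trace_sum, hAB, Matrix.trace_smul, Matrix.trace_one]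
    simp [mul_comm]
  have e₁ : ∑ a, ∑ b, ∑ c, (A a * B a).trace • (A b * B b * A c * B c) = (6 * k ^ 3) • 1 := by
    simp only [mul_assoc, ← Finset.smul_sum, ← Finset.mul_sum, hAB, hAB', mul_smul_comm,
      mul_one, ← Finset.sum_smul, htr]
    module
  have e₂ : ∑ a, ∑ b, ∑ c, (A a * B a).trace • (A b * B c * A c * B b) = (6 * k ^ 3) • 1 := by
    simp only [mul_assoc, ← Finset.smul_sum, ← Finset.mul_sum, hAB, hAB', hBA', mul_smul_comm,
      mul_one, ← Finset.sum_smul, htr]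
    module
  have e₃ : ∑ a, ∑ b, ∑ c, (A a * B b).trace • (A b * B a * A c * B c) = k • traceContr A B := by
    simp only [mul_assoc, ← Finset.smul_sum, ← Finset.mul_sum, hAB, hAB', hBA', mul_smul_comm,
      mul_one, traceContr, smul_comm _ k]
  have e₄ : ∑ a, ∑ b, ∑ c, (A a * B b).trace • (A b * B c * A c * B a) = k • traceContr A B := by
    simp only [mul_assoc, ← Finset.smul_sum, ← Finset.mul_sum, hAB, hAB', hBA', mul_smul_comm,
      mul_one, traceContr, smul_comm _ k]
  have e₅ : ∑ a, ∑ b, ∑ c, (A a * B c).trace • (A b * B b * A c * B a) = k • traceContr A B := by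
    have : ∀ a, ∑ b, ∑ c, (A a * B c).trace • (A b * B b * A c * B a)
        = ∑ c, ∑ b, (A a * B c).trace • (A b * B b * A c * B a) := fun a => Finset.sum_comm
    simp only [this]
    simp only [mul_assoc, ← Finset.smul_sum, ← Finset.mul_sum, hAB, hAB', hBA', mul_smul_comm,
      mul_one, traceContr, smul_comm _ k]
  simp only [Finset.sum_add_distrib, e₁, e₂, e₃, e₄, e₅]
  rw [crossContr]
  module

lemma sum_trace_mul_trace_smul (hAB : ∑ a, A a * B a = k • 1) :
    ∑ a, ∑ b, ∑ c, (((A a * B a).trace * (A b * B b).trace) • (A c * B c)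
      + ((A a * B a).trace * (A b * B c).trace) • (A c * B b)
      + ((A a * B b).trace * (A b * B a).trace) • (A c * B c)
      + ((A a * B b).trace * (A b * B c).trace) • (A c * B a)
      + ((A a * B c).trace * (A b * B a).trace) • (A c * B b)
      + ((A a * B c).trace * (A b * B b).trace) • (A c * B a))
      = (36 * k ^ 3) • 1 + (k * (traceContr A B).trace) • 1 + (12 * k) • traceContr A B
        + (2 : ℝ) • chainContr A B := by
  have htr : ∑ a, (A a * B a).trace = 6 * k := by
    rw [← Matrix.trace_sum, hAB, Matrix.trace_smul, Matrix.trace_one]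
    simp [mul_comm]
  have e₁ : ∑ a, ∑ b, ∑ c, ((A a * B a).trace * (A b * B b).trace) • (A c * B c)
      = (36 * k ^ 3) • 1 := by
    simp only [← Finset.smul_sum, hAB, ← Finset.sum_smul, ← Finset.mul_sum, htr,
      ← Finset.sum_mul]
    module
  have e₂ : ∑ a, ∑ b, ∑ c, ((A a * B a).trace * (A b * B c).trace) • (A c * B b)
      = (6 * k) • traceContr A B := by
    simp only [mul_smul, ← Finset.smul_sum, ← Finset.sum_smul, htr, traceContr]
  have e₃ : ∑ a, ∑ b, ∑ c, ((A a * B b).trace * (A b * B a).trace) • (A c * B c)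
      = (k * (traceContr A B).trace) • 1 := by
    simp only [← Finset.smul_sum, hAB, ← Finset.sum_smul, traceContr, Matrix.trace_sum,
      Matrix.trace_smul, smul_eq_mul]
    module
  have e₄ : ∑ a, ∑ b, ∑ c, ((A a * B c).trace * (A b * B a).trace) • (A c * B b)
      = chainContr A B := by
    rw [Finset.sum_comm, chainContr]
    simp only [mul_comm]
  have e₅ : ∑ a, ∑ b, ∑ c, ((A a * B c).trace * (A b * B b).trace) • (A c * B a)
      = (6 * k) • traceContr A B := by
    have : ∀ a, ∑ b, ∑ c, ((A a * B c).trace * (A b * B b).trace) • (A c * B a)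
        = ∑ c, ∑ b, ((A a * B c).trace * (A b * B b).trace) • (A c * B a) :=
      fun a => Finset.sum_comm
    simp only [this]
    simp only [← Finset.sum_smul, ← Finset.mul_sum, htr, mul_comm _ (6 * k), mul_smul (6 * k),
      ← Finset.smul_sum, traceContr]
  simp only [Finset.sum_add_distrib, e₁, e₂, e₃, e₄, e₅]
  rw [chainContr]
  module

lemma sum_trace_quadratic_smul (hAB : ∑ a, A a * B a = k • 1) (hBA : ∑ a, B a * A a = k • 1) :
    ∑ a, ∑ b, ∑ c, ((A a * B a * A b * B b).trace • (A c * B c)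
      + (A a * B a * A b * B c).trace • (A c * B b)
      + (A a * B b * A b * B a).trace • (A c * B c)
      + (A a * B b * A b * B c).trace • (A c * B a)
      + (A a * B c * A b * B a).trace • (A c * B b)
      + (A a * B c * A b * B b).trace • (A c * B a))
      = (12 * k ^ 3) • 1 + (4 * k) • traceContr A B := by
  have hAB' : ∀ Z, ∑ a, A a * (B a * Z) = k • Z := fun Z => by
    simp only [← mul_assoc, ← Finset.sum_mul, hAB, smul_mul_assoc, one_mul]
  have hBA' : ∀ Z, ∑ a, B a * (A a * Z) = k • Z := fun Z => by
    simp only [← mul_assoc, ← Finset.sum_mul, hBA, smul_mul_assoc, one_mul]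
  have ht1 : (1 : Matrix (Fin 6) (Fin 6) ℝ).trace = 6 := by simp
  have e₁ : ∑ a, ∑ b, ∑ c, (A a * B a * A b * B b).trace • (A c * B c) = (6 * k ^ 3) • 1 := by
    simp only [← Finset.smul_sum, hAB, ← Finset.sum_smul, ← Matrix.trace_sum, mul_assoc,
      ← Finset.mul_sum, mul_smul_comm, mul_one, Matrix.trace_smul, ht1]
    module
  have e₂ : ∑ a, ∑ b, ∑ c, (A a * B b * A b * B a).trace • (A c * B c) = (6 * k ^ 3) • 1 := by
    simp only [← Finset.smul_sum, hAB, hBA', ← Finset.sum_smul, ← Matrix.trace_sum, mul_assoc,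
      ← Finset.mul_sum, mul_smul_comm, mul_one, Matrix.trace_smul, ht1]
    module
  have swap₂ : ∀ G : ι → ι → ι → Matrix (Fin 6) (Fin 6) ℝ,
      ∑ a, ∑ b, ∑ c, G a b c = ∑ a, ∑ c, ∑ b, G a b c :=
    fun G => Finset.sum_congr rfl fun a _ => Finset.sum_comm
  have e₃ : ∑ a, ∑ b, ∑ c, (A a * B a * A b * B c).trace • (A c * B b)
      = k • traceContr A B := by
    rw [Finset.sum_comm, swap₂]
    simp only [← Finset.sum_smul, ← Matrix.trace_sum, mul_assoc, hAB', Matrix.trace_smul,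
      smul_eq_mul, mul_smul, ← Finset.smul_sum, traceContr]
  have e₄ : ∑ a, ∑ b, ∑ c, (A a * B b * A b * B c).trace • (A c * B a)
      = k • traceContr A B := by
    rw [swap₂]
    simp only [← Finset.sum_smul, ← Matrix.trace_sum, mul_assoc, ← Finset.mul_sum, hBA',
      mul_smul_comm, Matrix.trace_smul, smul_eq_mul, mul_smul, ← Finset.smul_sum, traceContr]
  have e₅ : ∑ a, ∑ b, ∑ c, (A a * B c * A b * B a).trace • (A c * B b)
      = k • traceContr A B := by
    have : ∀ a b c, (A a * B c * A b * B a).trace = (B a * (A a * (B c * A b))).trace := by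
      intro a b c
      rw [Matrix.trace_mul_comm]
      simp only [mul_assoc]
    simp only [this]
    rw [Finset.sum_comm, swap₂]
    simp only [← Finset.sum_smul, ← Matrix.trace_sum, hBA', Matrix.trace_smul,
      smul_eq_mul, mul_smul, ← Finset.smul_sum, traceContr, Matrix.trace_mul_comm (B _) (A _)]
  have e₆ : ∑ a, ∑ b, ∑ c, (A a * B c * A b * B b).trace • (A c * B a)
      = k • traceContr A B := by
    rw [swap₂]
    simp only [← Finset.sum_smul, ← Matrix.trace_sum, mul_assoc, ← Finset.mul_sum, hAB,
      mul_smul_comm, mul_one, Matrix.trace_smul, smul_eq_mul, mul_smul, ← Finset.smul_sum,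
      traceContr]
  simp only [Finset.sum_add_distrib, e₁, e₂, e₃, e₄, e₅, e₆]
  module

/-- The contracted form of the identity `skew_mul_skew_cube` for a tensor `∑ Aₐ ⊗ Bₐ` of Einstein
type. -/
theorem contracted_identity (hA : ∀ a, (A a)ᵀ = -A a) (hB : ∀ a, (B a)ᵀ = -B a)
    (hAB : ∑ a, A a * B a = k • 1) (hBA : ∑ a, B a * A a = k • 1) :
    (24 : ℝ) • cyclicContr A B - (12 : ℝ) • crossContr A B + (6 : ℝ) • chainContr A B
      - (24 * k) • traceContr A B
      + (3 * k * (traceContr A B).trace + 3 * (crossContr A B).trace - (chainContr A B).trace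
          - 4 * (cyclicContr A B).trace) • (1 : Matrix (Fin 6) (Fin 6) ℝ) = 0 := by
  have h₁ := sum_cubic hAB hBA
  have h₂ := sum_trace_smul_quadratic hAB hBA
  have h₃ := sum_trace_mul_trace_smul hAB
  have h₄ := sum_trace_quadratic_smul hAB hBA
  have h := sum_symHalfCharpoly hA hB
  -- The scalar term of the cubic is a combination of traces of `M₁`, `M₂`, `M₃`, so the four
  -- contractions above determine everything.
  have key : ∀ (M₁ M₂ M₃ M₄ : ι → ι → ι → Matrix (Fin 6) (Fin 6) ℝ)
      (S₁ S₂ S₃ S₄ : Matrix (Fin 6) (Fin 6) ℝ), ∑ a, ∑ b, ∑ c, M₁ a b c = S₁ →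
      ∑ a, ∑ b, ∑ c, M₂ a b c = S₂ → ∑ a, ∑ b, ∑ c, M₃ a b c = S₃ →
      ∑ a, ∑ b, ∑ c, M₄ a b c = S₄ →
      (∀ a b c, M₁ a b c - (1 / 2 : ℝ) • M₂ a b c + (1 / 8 : ℝ) • M₃ a b c
        - (1 / 4 : ℝ) • M₄ a b c - ((1 / 48) * (M₃ a b c).trace - (1 / 8) * (M₂ a b c).trace
          + (1 / 6) * (M₁ a b c).trace) • (1 : Matrix (Fin 6) (Fin 6) ℝ)
          = symHalfCharpoly (A a) (A b) (A c) (B a) (B b) (B c)) →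
      S₁ - (1 / 2 : ℝ) • S₂ + (1 / 8 : ℝ) • S₃ - (1 / 4 : ℝ) • S₄
        - ((1 / 48) * S₃.trace - (1 / 8) * S₂.trace + (1 / 6) * S₁.trace) •
          (1 : Matrix (Fin 6) (Fin 6) ℝ) = 0 := by
    intro M₁ M₂ M₃ M₄ S₁ S₂ S₃ S₄ h₁ h₂ h₃ h₄ hM
    simp only [← hM] at h
    rw [← h, ← h₁, ← h₂, ← h₃, ← h₄]
    simp only [Finset.sum_sub_distrib, Finset.sum_add_distrib, ← Finset.smul_sum,
      ← Finset.sum_smul, ← Finset.mul_sum, ← Matrix.trace_sum]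
  have e := key _ _ _ _ _ _ _ _ h₁ h₂ h₃ h₄ fun a b c => by
    simp only [symHalfCharpoly, halfCharpoly, Matrix.trace_add, Matrix.trace_smul, smul_eq_mul]
    module
  simp only [Matrix.trace_add, Matrix.trace_smul, Matrix.trace_one, Fintype.card_fin,
    smul_eq_mul, Nat.cast_ofNat] at e
  -- The factor 24 clears denominators; all `k ^ 3` terms cancel.
  have e' := congrArg (fun M => (24 : ℝ) • M) e
  rw [smul_zero] at e'
  rw [← e']
  module

end Contraction

/-! ### Index form of the four contractions -/

section Components

open Matrix

variable {ι : Type*} [Fintype ι]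

lemma sum_mul_sum_mul_sum (f g h : ι → ℝ) :
    (∑ a, f a) * (∑ b, g b) * (∑ c, h c) = ∑ a, ∑ b, ∑ c, f a * g b * h c := by
  rw [Finset.sum_mul_sum, Finset.sum_mul]
  exact Finset.sum_congr rfl fun a _ => Finset.sum_mul_sum _ _ _ _

lemma sum_comm_three {κ : Type*} [Fintype κ] (F : ι → ι → ι → κ → ℝ) :
    ∑ a, ∑ b, ∑ c, ∑ x, F a b c x = ∑ x, ∑ a, ∑ b, ∑ c, F a b c x := by
  have h₁ : ∀ a b, ∑ c, ∑ x, F a b c x = ∑ x, ∑ c, F a b c x := fun a b => Finset.sum_comm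
  have h₂ : ∀ a, ∑ b, ∑ x, ∑ c, F a b c x = ∑ x, ∑ b, ∑ c, F a b c x := fun a => Finset.sum_comm
  simp only [h₁, h₂]
  exact Finset.sum_comm

lemma sum_comm_two {κ : Type*} [Fintype κ] (F : ι → ι → κ → ℝ) :
    ∑ a, ∑ b, ∑ x, F a b x = ∑ x, ∑ a, ∑ b, F a b x := by
  have h₁ : ∀ a, ∑ b, ∑ x, F a b x = ∑ x, ∑ b, F a b x := fun a => Finset.sum_comm
  simp only [h₁]
  exact Finset.sum_comm

variable {A B : ι → Matrix (Fin 6) (Fin 6) ℝ} {R : Fin 6 → Fin 6 → Fin 6 → Fin 6 → ℝ}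

/-- Here and in the next three lemmas, the label shared by `A s` and `B s` is summed first, each
such pair becoming one factor `R`. -/
lemma traceContr_apply (hR : ∀ a b c d, R a b c d = ∑ s, A s a b * B s c d) (i j : Fin 6) :
    traceContr A B i j = ∑ z, ∑ x, ∑ y, R x y z j * R i z y x := by
  simp only [hR, traceContr, Matrix.sum_apply, Matrix.smul_apply, Matrix.trace, Matrix.diag_apply,
    Matrix.mul_apply, smul_eq_mul, Finset.mul_sum, Finset.sum_mul,
    sum_comm_two (ι := ι) (κ := Fin 6)]
  refine Finset.sum_congr rfl fun z _ => Finset.sum_congr rfl fun x _ =>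
    Finset.sum_congr rfl fun y _ => ?_
  rw [Finset.sum_comm]
  refine Finset.sum_congr rfl fun a _ => Finset.sum_congr rfl fun b _ => ?_
  ring

lemma crossContr_apply (hR : ∀ a b c d, R a b c d = ∑ s, A s a b * B s c d) (i j : Fin 6) :
    crossContr A B i j
      = ∑ m, ∑ l, ∑ k, ∑ x, ∑ y, R x y k l * R i k m j * R l m y x := by
  simp only [hR, sum_mul_sum_mul_sum]
  simp only [crossContr, Matrix.sum_apply, Matrix.smul_apply, Matrix.trace, Matrix.diag_apply,
    Matrix.mul_apply, smul_eq_mul, Finset.mul_sum, Finset.sum_mul,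
    sum_comm_three (ι := ι) (κ := Fin 6)]
  refine Finset.sum_congr rfl fun z _ => Finset.sum_congr rfl fun x _ =>
    Finset.sum_congr rfl fun y _ => Finset.sum_congr rfl fun y _ => Finset.sum_congr rfl fun y _ =>
    Finset.sum_congr rfl fun a _ => Finset.sum_congr rfl fun b _ =>
    Finset.sum_congr rfl fun c _ => ?_
  ring

lemma chainContr_apply (hR : ∀ a b c d, R a b c d = ∑ s, A s a b * B s c d) (i j : Fin 6) :
    chainContr A B i j
      = ∑ k, ∑ z, ∑ w, ∑ x, ∑ y, R x y k j * R z w y x * R i k w z := by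
  simp only [hR, sum_mul_sum_mul_sum]
  simp only [chainContr, Matrix.sum_apply, Matrix.smul_apply, Matrix.trace, Matrix.diag_apply,
    Matrix.mul_apply, smul_eq_mul, Finset.mul_sum, Finset.sum_mul,
    sum_comm_three (ι := ι) (κ := Fin 6)]
  refine Finset.sum_congr rfl fun z _ => Finset.sum_congr rfl fun x _ =>
    Finset.sum_congr rfl fun y _ => Finset.sum_congr rfl fun y _ => Finset.sum_congr rfl fun y _ =>
    Finset.sum_congr rfl fun a _ => Finset.sum_congr rfl fun b _ =>
    Finset.sum_congr rfl fun c _ => ?_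
  ring

lemma cyclicContr_apply (hR : ∀ a b c d, R a b c d = ∑ s, A s a b * B s c d) (i j : Fin 6) :
    cyclicContr A B i j
      = ∑ p, ∑ n, ∑ m, ∑ l, ∑ k, R i k m n * R l m p j * R n p k l := by
  simp only [hR, sum_mul_sum_mul_sum]
  simp only [cyclicContr, Matrix.sum_apply, Matrix.mul_apply, Finset.sum_mul,
    sum_comm_three (ι := ι) (κ := Fin 6)]
  refine Finset.sum_congr rfl fun z _ => Finset.sum_congr rfl fun x _ =>
    Finset.sum_congr rfl fun y _ => Finset.sum_congr rfl fun y _ => Finset.sum_congr rfl fun y _ =>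
    Finset.sum_congr rfl fun a _ => Finset.sum_congr rfl fun b _ =>
    Finset.sum_congr rfl fun c _ => ?_
  ring

end Components

/-! ### Exchanging adjacent summation indices -/

section SumSwap

variable {κ : Type*} [Fintype κ] (F : κ → κ → κ → κ → κ → ℝ)

lemma sum_swap₁₂ : ∑ a, ∑ b, ∑ c, ∑ d, ∑ e, F a b c d e = ∑ b, ∑ a, ∑ c, ∑ d, ∑ e, F a b c d e :=
  Finset.sum_comm

lemma sum_swap₂₃ : ∑ a, ∑ b, ∑ c, ∑ d, ∑ e, F a b c d e = ∑ a, ∑ c, ∑ b, ∑ d, ∑ e, F a b c d e :=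
  Finset.sum_congr rfl fun _ _ => Finset.sum_comm

lemma sum_swap₃₄ : ∑ a, ∑ b, ∑ c, ∑ d, ∑ e, F a b c d e = ∑ a, ∑ b, ∑ d, ∑ c, ∑ e, F a b c d e :=
  Finset.sum_congr rfl fun _ _ => Finset.sum_congr rfl fun _ _ => Finset.sum_comm

lemma sum_swap₄₅ : ∑ a, ∑ b, ∑ c, ∑ d, ∑ e, F a b c d e = ∑ a, ∑ b, ∑ c, ∑ e, ∑ d, F a b c d e :=
  Finset.sum_congr rfl fun _ _ => Finset.sum_congr rfl fun _ _ => Finset.sum_congr rfl fun _ _ =>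
    Finset.sum_comm

variable {F} in
lemma sum_congr₅ {G : κ → κ → κ → κ → κ → ℝ} (h : ∀ a b c d e, F a b c d e = G a b c d e) :
    ∑ a, ∑ b, ∑ c, ∑ d, ∑ e, F a b c d e = ∑ a, ∑ b, ∑ c, ∑ d, ∑ e, G a b c d e := by
  simp only [h]

end SumSwap

/-! ### Algebraic curvature tensors and the six-dimensional identity -/

section AlgebraicCurvature

/-- The algebraic symmetries of the components of a curvature tensor. -/
structure IsAlgCurv {n : ℕ} (R : Fin n → Fin n → Fin n → Fin n → ℝ) : Prop where
  skew_left : ∀ a b c d, R a b c d = -R b a c d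
  skew_right : ∀ a b c d, R a b c d = -R a b d c
  bianchi : ∀ a b c d, R a b c d + R b c a d + R c a b d = 0

namespace IsAlgCurv

/-- The classical octahedron argument: combine the Bianchi identities of the four cyclic shifts of
`a b c d`. -/
lemma pair {n : ℕ} {R : Fin n → Fin n → Fin n → Fin n → ℝ} (h : IsAlgCurv R) (a b c d : Fin n) :
    R a b c d = R c d a b := by
  linarith [h.bianchi a b c d, h.bianchi b c d a, h.bianchi c d a b, h.bianchi d a b c,
    h.skew_left a b c d, h.skew_left b c a d, h.skew_left c a b d, h.skew_left b c d a,
    h.skew_left c d b a, h.skew_left d b c a, h.skew_left c d a b, h.skew_left d a c b,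
    h.skew_left a c d b, h.skew_left d a b c, h.skew_left a b d c, h.skew_left b d a c,
    h.skew_right a b c d, h.skew_right b c a d, h.skew_right c a b d, h.skew_right c d a b,
    h.skew_right d a b c, h.skew_right b d a c, h.skew_right a c b d, h.skew_right d b a c]

variable {R : Fin 6 → Fin 6 → Fin 6 → Fin 6 → ℝ} {k : ℝ}

lemma traceContr_eq (h : IsAlgCurv R) (i j : Fin 6) :
    ∑ z, ∑ x, ∑ y, R x y z j * R i z y x = tildeR R i j := by
  refine Finset.sum_congr rfl fun z _ => ?_
  rw [Finset.sum_comm]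
  refine Finset.sum_congr rfl fun x _ => Finset.sum_congr rfl fun y _ => ?_
  rw [h.pair y x z j, h.skew_left z j y x, h.skew_right j z y x]
  ring

lemma crossContr_eq (h : IsAlgCurv R) (i j : Fin 6) :
    ∑ m, ∑ l, ∑ k, ∑ x, ∑ y, R x y k l * R i k m j * R l m y x = checkR R i j := by
  refine (sum_swap₂₃ _).trans <| (sum_swap₁₂ _).trans <| (sum_swap₃₄ _).trans <|
    (sum_swap₄₅ _).trans <| (sum_swap₃₄ _).trans <| sum_congr₅ fun k m y x l => ?_
  rw [h.skew_left x y k l, h.skew_right y x k l, h.pair l m y x]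
  ring

lemma chainContr_eq (h : IsAlgCurv R) (i j : Fin 6) :
    ∑ k, ∑ z, ∑ w, ∑ x, ∑ y, R x y k j * R z w y x * R i k w z = -hatR R i j := by
  simp only [hatR, ← Finset.sum_neg_distrib]
  refine (sum_swap₂₃ _).trans <| (sum_swap₄₅ _).trans <| sum_congr₅ fun k w z y x => ?_
  rw [h.pair x y k j, h.skew_left k j x y, h.skew_right j k x y, h.skew_left z w y x]
  ring

/-- The factor `R b d u v` antisymmetrizes the other two in `b, d` and in `u, v`; Bianchi turns each
antisymmetrization into a single component. Averaging four copies gives the factor 1/4. -/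
lemma sum_cross_ring (h : IsAlgCurv R) (i j : Fin 6) :
    ∑ b, ∑ c, ∑ d, ∑ u, ∑ v, R i b c d * R j u c v * R b d u v = (1 / 4) * hatR R i j := by
  have last : ∀ a b c d, R a b c d - R a d c b = R a c b d := fun a b c d => by
    linarith [h.bianchi b c d a, h.pair a b c d, h.pair a d c b, h.pair a c b d,
      h.pair b c d a, h.pair c d b a, h.pair d b c a, h.skew_right c d b a, h.skew_right d b c a,
      h.skew_right b c d a, h.skew_left b c a d, h.skew_left c b a d, h.skew_left b d a c,
      h.skew_right b d a c, h.skew_left c d a b, h.skew_left d b a c]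
  set Z := ∑ b, ∑ c, ∑ d, ∑ u, ∑ v, R i b c d * R j u c v * R b d u v with hZ
  have e₁ : Z = ∑ c, ∑ b, ∑ d, ∑ u, ∑ v, R i b c d * R j u c v * R b d u v := sum_swap₁₂ _
  have e₂ : Z = ∑ c, ∑ b, ∑ d, ∑ u, ∑ v, -(R i d c b * R j u c v * R b d u v) := by
    rw [e₁]
    refine (sum_swap₂₃ _).trans (sum_congr₅ fun c b d u v => ?_)
    rw [h.skew_left d b u v]
    ring
  have e₃ : Z = ∑ c, ∑ b, ∑ d, ∑ u, ∑ v, -(R i b c d * R j v c u * R b d u v) := by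
    rw [e₁]
    refine (sum_swap₄₅ _).trans (sum_congr₅ fun c b d u v => ?_)
    rw [h.skew_right b d v u]
    ring
  have e₄ : Z = ∑ c, ∑ b, ∑ d, ∑ u, ∑ v, R i d c b * R j v c u * R b d u v := by
    rw [e₂]
    refine (sum_swap₄₅ _).trans (sum_congr₅ fun c b d u v => ?_)
    rw [h.skew_right b d v u]
    ring
  have e₅ : 4 * Z = hatR R i j := by
    have : 4 * Z = Z + Z + Z + Z := by ring
    rw [this]
    nth_rw 1 [e₁]
    nth_rw 1 [e₂]
    nth_rw 1 [e₃]
    nth_rw 1 [e₄]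
    simp only [hatR, ← Finset.sum_add_distrib]
    refine sum_congr₅ fun c b d u v => ?_
    rw [← last i b c d, ← last j u c v]
    ring
  linarith

/-- Bianchi splits the last factor in two: one part gives `ringR`, the other the sum of
`sum_cross_ring`. -/
lemma cyclicContr_eq (h : IsAlgCurv R) (i j : Fin 6) :
    ∑ p, ∑ n, ∑ m, ∑ l, ∑ k, R i k m n * R l m p j * R n p k l
      = ringR R i j - (1 / 4) * hatR R i j := by
  rw [← h.sum_cross_ring i j]
  simp only [ringR, ← Finset.sum_sub_distrib]
  refine (sum_swap₄₅ _).trans <| (sum_swap₃₄ _).trans <| (sum_swap₂₃ _).trans <|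
    (sum_swap₁₂ _).trans <| (sum_swap₂₃ _).trans <| (sum_swap₃₄ _).trans <|
    (sum_swap₂₃ _).trans <| sum_congr₅ fun k m n p l => ?_
  have e : R n p k l = R k p n l - R k n p l := by
    linarith [h.bianchi k p n l, h.skew_left p n k l, h.skew_left n k p l]
  rw [e, h.pair l m p j, h.skew_left p j l m, h.skew_right j p l m]
  ring

lemma sum_tildeR : ∑ i, tildeR R i i = normSq R := rfl

lemma sum_hatR : ∑ i, hatR R i i = hatScalar R := rfl

lemma sum_ringR : ∑ i, ringR R i i = ringScalar R := rfl

/-- Exhibits `checkR` as the curvature acting on `tildeR`, so that its trace, and its value when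
`tildeR` is a multiple of the metric, reduce to Ricci contractions. -/
lemma checkR_eq (h : IsAlgCurv R) (i j : Fin 6) :
    checkR R i j = ∑ u, ∑ v, R i u v j * tildeR R u v := by
  refine Finset.sum_congr rfl fun u _ => Finset.sum_congr rfl fun v _ => ?_
  simp only [tildeR, Finset.mul_sum]
  rw [sum_comm_two]
  refine Finset.sum_congr rfl fun c _ => Finset.sum_congr rfl fun a _ =>
    Finset.sum_congr rfl fun b _ => ?_
  rw [h.pair a b c u, h.pair a b c v, h.skew_left c u, h.skew_left c v]
  ring

/-- The Einstein condition in an orthonormal frame. -/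
def IsEinsteinWith (R : Fin 6 → Fin 6 → Fin 6 → Fin 6 → ℝ) (k : ℝ) : Prop :=
  ∀ i j, ∑ a, R a i j a = if i = j then k else 0

lemma sum_checkR (h : IsAlgCurv R) (hE : IsEinsteinWith R k) :
    ∑ i, checkR R i i = k * normSq R := by
  simp only [h.checkR_eq]
  rw [Finset.sum_comm]
  have : ∀ u, ∑ i, ∑ v, R i u v i * tildeR R u v = k * tildeR R u u := by
    intro u
    rw [Finset.sum_comm]
    simp only [← Finset.sum_mul, hE _ _]
    simp
  simp only [this, ← Finset.mul_sum, sum_tildeR]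

/-- The vanishing of the sixth order Lovelock tensor of an Einstein curvature tensor in
dimension six. -/
theorem einstein_identity (h : IsAlgCurv R) (hE : IsEinsteinWith R k) (i j : Fin 6) :
    24 * k * tildeR R i j + 12 * checkR R i j + 12 * hatR R i j - 24 * ringR R i j
      = (6 * k * normSq R - 4 * ringScalar R + 2 * hatScalar R) * if i = j then 1 else 0 := by
  -- Decompose `R` along the elementary matrices in its last two slots. Antisymmetrizing these makes
  -- `B` skew, and the skewness of `R` in those slots ensures that `R` is still recovered.
  let A : Fin 6 × Fin 6 → Matrix (Fin 6) (Fin 6) ℝ := fun s => Matrix.of fun a b => R a b s.1 s.2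
  let B : Fin 6 × Fin 6 → Matrix (Fin 6) (Fin 6) ℝ := fun s => Matrix.of fun c d =>
    (1 / 2) * ((if s = (c, d) then 1 else 0) - (if s = (d, c) then 1 else 0))
  have hR : ∀ a b c d, R a b c d = ∑ s, A s a b * B s c d := by
    intro a b c d
    have : ∀ s, A s a b * B s c d = (1 / 2) * ((if s = (c, d) then R a b s.1 s.2 else 0)
        - (if s = (d, c) then R a b s.1 s.2 else 0)) := by
      intro s
      simp only [A, B, Matrix.of_apply]
      split_ifs <;> ring
    simp only [this, ← Finset.mul_sum, Finset.sum_sub_distrib, Finset.sum_ite_eq',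
      Finset.mem_univ, if_true]
    linarith [h.skew_right a b c d]
  have hA : ∀ s, (A s).transpose = -A s := fun s => by
    ext a b
    exact h.skew_left b a s.1 s.2
  have hB : ∀ s, (B s).transpose = -B s := fun s => by
    ext a b
    simp only [B, Matrix.transpose_apply, Matrix.of_apply, Matrix.neg_apply]
    ring
  have hAB : ∑ s, A s * B s = k • 1 := by
    ext a b
    simp only [Matrix.sum_apply, Matrix.mul_apply]
    rw [Finset.sum_comm]
    simp only [← hR]
    rw [Matrix.smul_apply, Matrix.one_apply, smul_eq_mul, mul_ite, mul_one, mul_zero, ← hE a b]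
    exact Finset.sum_congr rfl fun x _ => by rw [h.skew_left a x, h.skew_right x a, neg_neg]
  have hBA : ∑ s, B s * A s = k • 1 := by
    ext a b
    simp only [Matrix.sum_apply, Matrix.mul_apply]
    rw [Finset.sum_comm]
    simp only [mul_comm (B _ _ _), ← hR]
    rw [Matrix.smul_apply, Matrix.one_apply, smul_eq_mul, mul_ite, mul_one, mul_zero]
    simp only [eq_comm (a := a) (b := b)]
    exact hE b a
  have key := congrFun (congrFun (contracted_identity hA hB hAB hBA) i) j
  simp only [Matrix.sub_apply, Matrix.add_apply, Matrix.smul_apply, smul_eq_mul, Matrix.trace,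
    Matrix.diag_apply, traceContr_apply hR, crossContr_apply hR, chainContr_apply hR,
    cyclicContr_apply hR, h.traceContr_eq, h.crossContr_eq, h.chainContr_eq, h.cyclicContr_eq,
    h.sum_checkR hE, Finset.sum_sub_distrib, Finset.sum_neg_distrib, ← Finset.mul_sum,
    sum_tildeR, sum_hatR, sum_ringR, Matrix.one_apply, Matrix.zero_apply] at key
  linear_combination -key

end IsAlgCurv

end AlgebraicCurvature

/-! ### Smoothness and nondegeneracy of the metric in a chart -/

section MetricCoefficients

variable {n : ℕ} {M : Type*} [TopologicalSpace M]
  [ChartedSpace (EuclideanSpace ℝ (Fin n)) M] [IsManifold (𝓡 n) ∞ M] (g : Metric n M)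

lemma metricCoeff_symm (x₀ : M) (y : EuclideanSpace ℝ (Fin n)) (i j : Fin n) :
    metricCoeff g x₀ y i j = metricCoeff g x₀ y j i :=
  g.symm _ _ _

lemma contMDiffOn_coordVec (x₀ : M) (i : Fin n) :
    ContMDiffOn 𝓘(ℝ, EuclideanSpace ℝ (Fin n)) (𝓡 n).tangent ∞
      (fun y => TotalSpace.mk' (EuclideanSpace ℝ (Fin n)) (E := fun x : M => TangentSpace (𝓡 n) x)
        ((extChartAt (𝓡 n) x₀).symm y) (coordVec x₀ y i)) (extChartAt (𝓡 n) x₀).target := by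
  have ho := isOpen_extChartAt_target (I := 𝓡 n) x₀
  have h₁ : ContMDiffOn 𝓘(ℝ, EuclideanSpace ℝ (Fin n)) (𝓡 n) ∞ (extChartAt (𝓡 n) x₀).symm
      (extChartAt (𝓡 n) x₀).target := contMDiffOn_extChartAt_symm x₀
  have h₂ := h₁.contMDiffOn_tangentMapWithin (m := ∞) (by simp) ho.uniqueMDiffOn
  have h₃ : ContMDiffOn 𝓘(ℝ, EuclideanSpace ℝ (Fin n)) 𝓘(ℝ, EuclideanSpace ℝ (Fin n)).tangent ∞
      (fun y => (⟨y, EuclideanSpace.single i (1 : ℝ)⟩ :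
        TangentBundle 𝓘(ℝ, EuclideanSpace ℝ (Fin n)) (EuclideanSpace ℝ (Fin n))))
      (extChartAt (𝓡 n) x₀).target := by
    intro y _
    exact contMDiffWithinAt_vectorSpace_iff_contDiffWithinAt.mpr contDiffWithinAt_const
  refine (h₂.comp h₃ fun y hy => hy).congr fun y hy => ?_
  simp only [Function.comp, tangentMapWithin, coordVec, TotalSpace.mk']
  rw [mfderivWithin_of_isOpen ho hy]

lemma contDiffAt_metricCoeff (x₀ : M) {y : EuclideanSpace ℝ (Fin n)}
    (hy : y ∈ (extChartAt (𝓡 n) x₀).target) (i j : Fin n) :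
    ContDiffAt ℝ ∞ (fun z => metricCoeff g x₀ z i j) y := by
  have hn := (isOpen_extChartAt_target (I := 𝓡 n) x₀).mem_nhds hy
  have hi := (contMDiffOn_coordVec x₀ i).contMDiffAt hn
  have hj := (contMDiffOn_coordVec x₀ j).contMDiffAt hn
  have hs := (contMDiffOn_extChartAt_symm (I := 𝓡 n) (n := ∞) x₀).contMDiffAt hn
  have hg := g.contMDiff.contMDiffAt.comp y hs
  have h := ContMDiffAt.clm_bundle_apply₂ (E₃ := Bundle.Trivial M ℝ) (F₃ := ℝ)
    (b := (extChartAt (𝓡 n) x₀).symm) hg hi hj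
  rw [contMDiffAt_totalSpace] at h
  exact contMDiffAt_iff_contDiffAt.mp h.2

lemma mfderiv_extChartAt_symm_injective (x₀ : M) {y : EuclideanSpace ℝ (Fin n)}
    (hy : y ∈ (extChartAt (𝓡 n) x₀).target) :
    Function.Injective (mfderiv 𝓘(ℝ, EuclideanSpace ℝ (Fin n)) (𝓡 n)
      (extChartAt (𝓡 n) x₀).symm y) := by
  have h := mfderiv_extChartAt_comp_mfderivWithin_extChartAt_symm (I := 𝓡 n) hy
  rw [ModelWithCorners.range_eq_univ, mfderivWithin_univ] at h
  intro v w hvw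
  have hv := congrArg (fun L => L v) h
  have hw := congrArg (fun L => L w) h
  exact hv.symm.trans ((congrArg (mfderiv (𝓡 n) 𝓘(ℝ, EuclideanSpace ℝ (Fin n))
    (extChartAt (𝓡 n) x₀) ((extChartAt (𝓡 n) x₀).symm y)) hvw).trans hw)

/-- A kernel vector of the Gram matrix would be the coordinate vector of a nonzero tangent vector of
length zero. -/
lemma det_metricCoeff_ne_zero (x₀ : M) {y : EuclideanSpace ℝ (Fin n)}
    (hy : y ∈ (extChartAt (𝓡 n) x₀).target) : (metricCoeff g x₀ y).det ≠ 0 := by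
  intro h0
  obtain ⟨v, hv, hv0⟩ := Matrix.exists_mulVec_eq_zero_iff.mpr h0
  set L := mfderiv 𝓘(ℝ, EuclideanSpace ℝ (Fin n)) (𝓡 n) (extChartAt (𝓡 n) x₀).symm y with hL
  let w : EuclideanSpace ℝ (Fin n) := WithLp.toLp 2 v
  have hw : w = ∑ i, v i • EuclideanSpace.single i (1 : ℝ) := by
    ext k
    simp [w, Pi.single_apply]
  have hLw : L w = ∑ i, v i • coordVec x₀ y i := by
    rw [hw]
    erw [map_sum]
    refine Finset.sum_congr rfl fun i _ => ?_
    erw [map_smul]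
    rfl
  have hne : L w ≠ 0 := by
    intro h
    apply hv
    have := mfderiv_extChartAt_symm_injective x₀ hy (h.trans (map_zero L).symm)
    exact congrArg WithLp.ofLp this
  have hpos := g.pos _ (L w) hne
  have hzero : g.inner ((extChartAt (𝓡 n) x₀).symm y) (L w) (L w) = 0 := by
    rw [hLw]
    simp only [map_sum, map_smul, sum_apply, smul_apply,
      smul_eq_mul]
    have hj : ∀ j, ∑ i, v i * g.inner ((extChartAt (𝓡 n) x₀).symm y) (coordVec x₀ y i)
        (coordVec x₀ y j) = 0 := fun j => by
      have := congrFun hv0 j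
      simp only [Matrix.mulVec, dotProduct, metricCoeff, Matrix.of_apply, Pi.zero_apply] at this
      rw [← this]
      exact Finset.sum_congr rfl fun i _ => by rw [mul_comm, g.symm]
    simp only [hj, mul_zero, Finset.sum_const_zero]
  linarith

end MetricCoefficients

/-! ### Calculus of partial derivatives -/

section PartialDeriv

variable {n : ℕ} {f h : EuclideanSpace ℝ (Fin n) → ℝ} {y : EuclideanSpace ℝ (Fin n)}

lemma partialDeriv_congr (hfh : f =ᶠ[nhds y] h) (i : Fin n) :
    partialDeriv i f y = partialDeriv i h y := by
  rw [partialDeriv, partialDeriv, hfh.fderiv_eq]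

lemma partialDeriv_add (hf : DifferentiableAt ℝ f y) (hh : DifferentiableAt ℝ h y) (i : Fin n) :
    partialDeriv i (fun z => f z + h z) y = partialDeriv i f y + partialDeriv i h y := by
  simp only [partialDeriv]
  rw [fderiv_fun_add hf hh]
  rfl

lemma partialDeriv_sub (hf : DifferentiableAt ℝ f y) (hh : DifferentiableAt ℝ h y) (i : Fin n) :
    partialDeriv i (fun z => f z - h z) y = partialDeriv i f y - partialDeriv i h y := by
  simp only [partialDeriv]
  rw [fderiv_fun_sub hf hh]
  rfl

lemma partialDeriv_const_mul (hf : DifferentiableAt ℝ f y) (c : ℝ) (i : Fin n) :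
    partialDeriv i (fun z => c * f z) y = c * partialDeriv i f y := by
  simp only [partialDeriv]
  rw [fderiv_const_mul hf]
  rfl

lemma partialDeriv_mul (hf : DifferentiableAt ℝ f y) (hh : DifferentiableAt ℝ h y) (i : Fin n) :
    partialDeriv i (fun z => f z * h z) y = partialDeriv i f y * h y + f y * partialDeriv i h y := by
  simp only [partialDeriv]
  rw [fderiv_fun_mul hf hh]
  simp only [add_apply, smul_apply, smul_eq_mul]
  ring

lemma partialDeriv_sum {ι : Type*} [Fintype ι] {F : ι → EuclideanSpace ℝ (Fin n) → ℝ}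
    (hF : ∀ l, DifferentiableAt ℝ (F l) y) (i : Fin n) :
    partialDeriv i (fun z => ∑ l, F l z) y = ∑ l, partialDeriv i (F l) y := by
  simp only [partialDeriv]
  rw [fderiv_fun_sum fun l _ => hF l]
  simp

lemma contDiffAt_partialDeriv (hf : ContDiffAt ℝ ∞ f y) (i : Fin n) :
    ContDiffAt ℝ ∞ (partialDeriv i f) y :=
  (hf.fderiv_right (m := ∞) (by simp)).clm_apply contDiffAt_const

lemma partialDeriv_comm (hf : ContDiffAt ℝ ∞ f y) (i j : Fin n) :
    partialDeriv i (partialDeriv j f) y = partialDeriv j (partialDeriv i f) y := by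
  have hs : IsSymmSndFDerivAt ℝ f y := hf.isSymmSndFDerivAt (by
    simpa using WithTop.coe_le_coe.2 (le_top : (2 : ℕ∞) ≤ ⊤))
  have hd : DifferentiableAt ℝ (fderiv ℝ f) y :=
    (hf.fderiv_right (m := ∞) (by simp)).differentiableAt (by simp)
  have key : ∀ i j : Fin n, partialDeriv i (partialDeriv j f) y
      = fderiv ℝ (fderiv ℝ f) y (EuclideanSpace.single i (1 : ℝ))
        (EuclideanSpace.single j (1 : ℝ)) := by
    intro i j
    change fderiv ℝ (fun z => fderiv ℝ f z (EuclideanSpace.single j (1 : ℝ))) y _ = _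
    rw [fderiv_clm_apply hd (differentiableAt_const _)]
    simp
  rw [key, key, hs.eq]

end PartialDeriv

/-! ### Smoothness of the inverse matrix -/

section Inverse

variable {n : ℕ} {E : Type*} [NormedAddCommGroup E] [NormedSpace ℝ E]

lemma contDiffAt_det {N : E → Matrix (Fin n) (Fin n) ℝ} {y : E}
    (hN : ∀ i j, ContDiffAt ℝ ∞ (fun z => N z i j) y) :
    ContDiffAt ℝ ∞ (fun z => (N z).det) y := by
  simp only [Matrix.det_apply']
  exact ContDiffAt.sum fun σ _ => contDiffAt_const.mul (contDiffAt_prod fun i _ => hN _ _)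

lemma contDiffAt_inv_apply {N : E → Matrix (Fin n) (Fin n) ℝ} {y : E}
    (hN : ∀ i j, ContDiffAt ℝ ∞ (fun z => N z i j) y) (h0 : (N y).det ≠ 0) (i j : Fin n) :
    ContDiffAt ℝ ∞ (fun z => (N z)⁻¹ i j) y := by
  simp only [Matrix.inv_def, Ring.inverse_eq_inv', Matrix.smul_apply, smul_eq_mul,
    Matrix.adjugate_apply]
  refine ((contDiffAt_det hN).inv h0).mul (contDiffAt_det fun k l => ?_)
  simp only [Matrix.updateRow_apply]
  split_ifs
  · exact contDiffAt_const
  · exact hN k l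

end Inverse

/-! ### Symmetries of the curvature in coordinates -/

section CurvatureSymmetries

variable {n : ℕ} {M : Type*} [TopologicalSpace M]
  [ChartedSpace (EuclideanSpace ℝ (Fin n)) M] [IsManifold (𝓡 n) ∞ M] (g : Metric n M)
  (x₀ : M) {y : EuclideanSpace ℝ (Fin n)}

lemma christoffel_symm (k i j : Fin n) : christoffel g x₀ k i j = christoffel g x₀ k j i := by
  funext z
  simp only [christoffel]
  congr 1
  refine Finset.sum_congr rfl fun l _ => ?_
  simp only [metricCoeff_symm g x₀ _ i j]
  ring

lemma contDiffAt_christoffel (hy : y ∈ (extChartAt (𝓡 n) x₀).target) (k i j : Fin n) :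
    ContDiffAt ℝ ∞ (christoffel g x₀ k i j) y := by
  have hG : ∀ i j, ContDiffAt ℝ ∞ (fun z => metricCoeff g x₀ z i j) y :=
    contDiffAt_metricCoeff g x₀ hy
  have hD : ∀ a i j, ContDiffAt ℝ ∞ (partialDeriv a fun z => metricCoeff g x₀ z i j) y :=
    fun a i j => contDiffAt_partialDeriv (hG i j) a
  exact contDiffAt_const.mul (ContDiffAt.sum fun l _ =>
    (contDiffAt_inv_apply hG (det_metricCoeff_ne_zero g x₀ hy) k l).mul
      (((hD i j l).add (hD j i l)).sub (hD l i j)))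

lemma sum_christoffel_mul_metricCoeff (hy : y ∈ (extChartAt (𝓡 n) x₀).target) (i k m : Fin n) :
    ∑ l, christoffel g x₀ l i k y * metricCoeff g x₀ y l m
      = (1 / 2) * (partialDeriv i (fun z => metricCoeff g x₀ z k m) y
        + partialDeriv k (fun z => metricCoeff g x₀ z i m) y
        - partialDeriv m (fun z => metricCoeff g x₀ z i k) y) := by
  have hinv : metricCoeff g x₀ y * (metricCoeff g x₀ y)⁻¹ = 1 :=
    Matrix.mul_nonsing_inv _ (isUnit_iff_ne_zero.mpr (det_metricCoeff_ne_zero g x₀ hy))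
  have hδ : ∀ p, ∑ l, metricCoeff g x₀ y m l * (metricCoeff g x₀ y)⁻¹ l p
      = if m = p then 1 else 0 := fun p => by
    rw [← Matrix.mul_apply, hinv, Matrix.one_apply]
  simp only [christoffel, mul_assoc, ← Finset.mul_sum, Finset.sum_mul]
  congr 1
  rw [Finset.sum_comm]
  set D : Fin n → ℝ := fun p => partialDeriv i (fun z => metricCoeff g x₀ z k p) y
        + partialDeriv k (fun z => metricCoeff g x₀ z i p) y
        - partialDeriv p (fun z => metricCoeff g x₀ z i k) y with hD
  have : ∀ p, ∑ l, (metricCoeff g x₀ y)⁻¹ l p * (D p * metricCoeff g x₀ y l m)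
      = D p * if m = p then 1 else 0 := fun p => by
    rw [← hδ, Finset.mul_sum]
    refine Finset.sum_congr rfl fun l _ => ?_
    rw [metricCoeff_symm g x₀ y l m]
    ring
  refine (Finset.sum_congr rfl fun p _ => this p).trans ?_
  simp [hD]

/-- Compatibility of the Levi-Civita connection with the metric. -/
lemma partialDeriv_metricCoeff (hy : y ∈ (extChartAt (𝓡 n) x₀).target) (i l m : Fin n) :
    partialDeriv i (fun z => metricCoeff g x₀ z l m) y
      = ∑ q, christoffel g x₀ q i l y * metricCoeff g x₀ y q m
        + ∑ q, christoffel g x₀ q i m y * metricCoeff g x₀ y q l := by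
  rw [sum_christoffel_mul_metricCoeff g x₀ hy, sum_christoffel_mul_metricCoeff g x₀ hy]
  simp only [metricCoeff_symm g x₀ _ m l]
  ring

/-- The product `g(∇_{∂ⱼ} ∂ₖ, ∇_{∂ᵢ} ∂ₘ)`. -/
noncomputable def christoffelProd (y : EuclideanSpace ℝ (Fin n)) (j k i m : Fin n) : ℝ :=
  ∑ p, ∑ q, christoffel g x₀ p j k y * christoffel g x₀ q i m y * metricCoeff g x₀ y q p

lemma christoffelProd_comm (j k i m : Fin n) :
    christoffelProd g x₀ y j k i m = christoffelProd g x₀ y i m j k := by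
  rw [christoffelProd, Finset.sum_comm]
  refine Finset.sum_congr rfl fun p _ => Finset.sum_congr rfl fun q _ => ?_
  rw [metricCoeff_symm g x₀ y p q]
  ring

/-- The components `g(R(∂ᵢ, ∂ⱼ) ∂ₖ, ∂ₘ)` of the curvature tensor in coordinates. -/
noncomputable def curvLower (y : EuclideanSpace ℝ (Fin n)) (i j k m : Fin n) : ℝ :=
  ∑ l, curvCoeff g x₀ l i j k y * metricCoeff g x₀ y l m

/-- Differentiate the lowered Christoffel symbols by the Leibniz rule and expand the derivative of
the metric by compatibility. The first double sum is exactly what cancels the quadratic terms of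
`curvCoeff`. -/
lemma sum_partialDeriv_christoffel (hy : y ∈ (extChartAt (𝓡 n) x₀).target) (i j k m : Fin n) :
    ∑ l, partialDeriv i (christoffel g x₀ l j k) y * metricCoeff g x₀ y l m
      = (1 / 2) * (partialDeriv i (partialDeriv j fun z => metricCoeff g x₀ z k m) y
        + partialDeriv i (partialDeriv k fun z => metricCoeff g x₀ z j m) y
        - partialDeriv i (partialDeriv m fun z => metricCoeff g x₀ z j k) y)
        - ∑ p, ∑ q, christoffel g x₀ p j k y * christoffel g x₀ q i p y
            * metricCoeff g x₀ y q m
        - christoffelProd g x₀ y j k i m := by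
  have hG : ∀ i j, ContDiffAt ℝ ∞ (fun z => metricCoeff g x₀ z i j) y :=
    contDiffAt_metricCoeff g x₀ hy
  have hG' : ∀ i j, DifferentiableAt ℝ (fun z => metricCoeff g x₀ z i j) y :=
    fun i j => (hG i j).differentiableAt (by simp)
  have hD : ∀ a i j, DifferentiableAt ℝ (partialDeriv a fun z => metricCoeff g x₀ z i j) y :=
    fun a i j => (contDiffAt_partialDeriv (hG i j) a).differentiableAt (by simp)
  have hΓ : ∀ k i j, DifferentiableAt ℝ (christoffel g x₀ k i j) y :=
    fun k i j => (contDiffAt_christoffel g x₀ hy k i j).differentiableAt (by simp)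
  -- The equality is needed near `y`, not only at `y`, because it is differentiated.
  have hev : (fun z => ∑ l, christoffel g x₀ l j k z * metricCoeff g x₀ z l m) =ᶠ[nhds y]
      fun z => (1 / 2) * (partialDeriv j (fun z => metricCoeff g x₀ z k m) z
        + partialDeriv k (fun z => metricCoeff g x₀ z j m) z
        - partialDeriv m (fun z => metricCoeff g x₀ z j k) z) := by
    filter_upwards [(isOpen_extChartAt_target (I := 𝓡 n) x₀).mem_nhds hy] with z hz
    exact sum_christoffel_mul_metricCoeff g x₀ hz j k m
  have h := partialDeriv_congr hev i
  rw [partialDeriv_sum (fun l => (hΓ l j k).fun_mul (hG' l m)),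
    partialDeriv_const_mul (((hD j k m).fun_add (hD k j m)).fun_sub (hD m j k)),
    partialDeriv_sub ((hD j k m).fun_add (hD k j m)) (hD m j k),
    partialDeriv_add (hD j k m) (hD k j m)] at h
  simp only [partialDeriv_mul (hΓ _ j k) (hG' _ m), Finset.sum_add_distrib] at h
  have h₂ : ∑ l, christoffel g x₀ l j k y * partialDeriv i (fun z => metricCoeff g x₀ z l m) y
      = ∑ p, ∑ q, christoffel g x₀ p j k y * christoffel g x₀ q i p y
            * metricCoeff g x₀ y q m + christoffelProd g x₀ y j k i m := by
    simp only [partialDeriv_metricCoeff g x₀ hy, mul_add, Finset.sum_add_distrib, Finset.mul_sum,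
      christoffelProd, mul_assoc]
  linarith

/-- The derivatives `∂ᵢ∂ⱼ gₖₘ` cancel by symmetry of second derivatives. In the remaining formula
the curvature symmetries can be read off. -/
lemma curvLower_eq (hy : y ∈ (extChartAt (𝓡 n) x₀).target) (i j k m : Fin n) :
    curvLower g x₀ y i j k m
      = (1 / 2) * (partialDeriv i (partialDeriv k fun z => metricCoeff g x₀ z j m) y
        - partialDeriv i (partialDeriv m fun z => metricCoeff g x₀ z j k) y
        - partialDeriv j (partialDeriv k fun z => metricCoeff g x₀ z i m) y
        + partialDeriv j (partialDeriv m fun z => metricCoeff g x₀ z i k) y)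
        - christoffelProd g x₀ y j k i m + christoffelProd g x₀ y i k j m := by
  have hU : ∀ i j, ∑ l, (∑ p, christoffel g x₀ l i p y * christoffel g x₀ p j k y)
        * metricCoeff g x₀ y l m
      = ∑ p, ∑ q, christoffel g x₀ p j k y * christoffel g x₀ q i p y
            * metricCoeff g x₀ y q m := fun i j => by
    simp only [Finset.sum_mul]
    rw [Finset.sum_comm]
    exact Finset.sum_congr rfl fun p _ => Finset.sum_congr rfl fun q _ => by ring
  have h₁ := sum_partialDeriv_christoffel g x₀ hy i j k m
  have h₂ := sum_partialDeriv_christoffel g x₀ hy j i k m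
  have h₃ := partialDeriv_comm (contDiffAt_metricCoeff g x₀ hy k m) i j
  simp only [curvLower, curvCoeff, add_mul, sub_mul, Finset.sum_add_distrib,
    Finset.sum_sub_distrib, hU]
  linarith

lemma isAlgCurv_curvLower (hy : y ∈ (extChartAt (𝓡 n) x₀).target) :
    IsAlgCurv (curvLower g x₀ y) where
  skew_left i j k m := by
    rw [curvLower_eq g x₀ hy, curvLower_eq g x₀ hy]
    ring
  skew_right i j k m := by
    rw [curvLower_eq g x₀ hy, curvLower_eq g x₀ hy, christoffelProd_comm g x₀ j m i k,
      christoffelProd_comm g x₀ i m j k]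
    ring
  bianchi i j k m := by
    rw [curvLower_eq g x₀ hy, curvLower_eq g x₀ hy, curvLower_eq g x₀ hy]
    simp only [christoffelProd, christoffel_symm g x₀ _ k j, christoffel_symm g x₀ _ k i,
      christoffel_symm g x₀ _ j i, metricCoeff_symm g x₀ _ k j, metricCoeff_symm g x₀ _ k i,
      metricCoeff_symm g x₀ _ j i, partialDeriv_comm (contDiffAt_metricCoeff g x₀ hy _ _) _ m]
    rw [partialDeriv_comm (contDiffAt_metricCoeff g x₀ hy j m) k i,
      partialDeriv_comm (contDiffAt_metricCoeff g x₀ hy i m) k j,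
      partialDeriv_comm (contDiffAt_metricCoeff g x₀ hy k m) j i]
    ring

end CurvatureSymmetries

/-! ### Passage from coordinates to frames -/

section Frames

variable {n : ℕ} {M : Type*} [TopologicalSpace M]
  [ChartedSpace (EuclideanSpace ℝ (Fin n)) M] [IsManifold (𝓡 n) ∞ M] (g : Metric n M) (p : M)

lemma chartDeriv_eq_id :
    chartDeriv n p = ContinuousLinearMap.id ℝ (EuclideanSpace ℝ (Fin n)) := by
  have : IsManifold (𝓡 n) 1 M := .of_le (n := ∞) (by simp)
  exact mfderiv_extChartAt_self (I := 𝓡 n) (x := p)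

lemma coordVec_self (i : Fin n) :
    coordVec p (extChartAt (𝓡 n) p p) i = EuclideanSpace.single i (1 : ℝ) := by
  have : IsManifold (𝓡 n) 1 M := .of_le (n := ∞) (by simp)
  have h := mfderivWithin_range_extChartAt_symm (I := 𝓡 n) (x := p)
  rw [ModelWithCorners.range_eq_univ, mfderivWithin_univ] at h
  exact congrArg (fun L : EuclideanSpace ℝ (Fin n) →L[ℝ] EuclideanSpace ℝ (Fin n) =>
    L (EuclideanSpace.single i (1 : ℝ))) h

lemma metricCoeff_self (i j : Fin n) :
    metricCoeff g p (extChartAt (𝓡 n) p p) i j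
      = g.inner p (EuclideanSpace.single i (1 : ℝ) : EuclideanSpace ℝ (Fin n))
        (EuclideanSpace.single j (1 : ℝ) : EuclideanSpace ℝ (Fin n)) := by
  -- The base point on the left is `p` sent through the chart and back, equal to `p` only
  -- propositionally.
  have transport : ∀ (q : M) (_ : q = p) (V W : EuclideanSpace ℝ (Fin n)),
      g.inner q V W = g.inner p V W := by
    rintro q rfl V W
    rfl
  rw [metricCoeff, Matrix.of_apply, coordVec_self, coordVec_self]
  exact transport _ (extChartAt_to_inv p) _ _

lemma inner_single_left (l : Fin n) (W : TangentSpace (𝓡 n) p) :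
    g.inner p ((chartDeriv n p).inverse (EuclideanSpace.single l (1 : ℝ))) W
      = ∑ m, chartDeriv n p W m * metricCoeff g p (extChartAt (𝓡 n) p p) l m := by
  have hinv : (chartDeriv n p).inverse (EuclideanSpace.single l (1 : ℝ))
      = (EuclideanSpace.single l (1 : ℝ) : EuclideanSpace ℝ (Fin n)) := by
    rw [chartDeriv_eq_id]
    exact congrArg (fun L : EuclideanSpace ℝ (Fin n) →L[ℝ] EuclideanSpace ℝ (Fin n) =>
      L (EuclideanSpace.single l (1 : ℝ))) ContinuousLinearMap.inverse_id
  have hW : W = ∑ m, chartDeriv n p W m •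
      (EuclideanSpace.single m (1 : ℝ) : EuclideanSpace ℝ (Fin n)) := by
    rw [chartDeriv_eq_id]
    refine PiLp.ext fun k => ?_
    simp [Pi.single_apply]
    rfl
  rw [hinv]
  conv_lhs => rw [hW]
  simp only [metricCoeff_self]
  erw [map_sum]
  refine Finset.sum_congr rfl fun m _ => ?_
  erw [map_smul]
  rfl

lemma curv4_eq (X Y Z W : TangentSpace (𝓡 n) p) :
    curv4 g p X Y Z W = ∑ i, ∑ j, ∑ k, ∑ m, chartDeriv n p X i * chartDeriv n p Y j *
      chartDeriv n p Z k * chartDeriv n p W m *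
        curvLower g p (extChartAt (𝓡 n) p p) i j k m := by
  simp only [curv4, curv, map_sum, map_smul, sum_apply, smul_apply, smul_eq_mul,
    inner_single_left, curvLower, Finset.mul_sum]
  refine Finset.sum_congr rfl fun i _ => Finset.sum_congr rfl fun j _ =>
    Finset.sum_congr rfl fun k _ => ?_
  rw [Finset.sum_comm]
  exact Finset.sum_congr rfl fun m _ => Finset.sum_congr rfl fun l _ => by ring

/-- The symmetries are multilinear, so they pass from the coordinate basis to any family of vectors;
the sums only need reindexing. -/
lemma isAlgCurv_comp (e : Fin n → TangentSpace (𝓡 n) p) : IsAlgCurv (comp g p e) := by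
  have h := isAlgCurv_curvLower g p (mem_extChartAt_target (I := 𝓡 n) p)
  refine ⟨fun a b c d => ?_, fun a b c d => ?_, fun a b c d => ?_⟩
  · simp only [comp, curv4_eq]
    rw [Finset.sum_comm]
    simp only [← Finset.sum_neg_distrib]
    refine Finset.sum_congr rfl fun i _ => Finset.sum_congr rfl fun j _ =>
      Finset.sum_congr rfl fun k _ => Finset.sum_congr rfl fun m _ => ?_
    rw [h.skew_left j i]
    ring
  · simp only [comp, curv4_eq, ← Finset.sum_neg_distrib]
    refine Finset.sum_congr rfl fun i _ => Finset.sum_congr rfl fun j _ => ?_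
    rw [Finset.sum_comm]
    refine Finset.sum_congr rfl fun k _ => Finset.sum_congr rfl fun m _ => ?_
    rw [h.skew_right i j m k]
    ring
  · have rot : ∀ F : Fin n → Fin n → Fin n → ℝ,
        ∑ i, ∑ j, ∑ k, F i j k = ∑ k, ∑ i, ∑ j, F i j k := sum_comm_two
    simp only [comp, curv4_eq]
    rw [rot fun i j k => ∑ m, chartDeriv n p (e b) i * chartDeriv n p (e c) j *
      chartDeriv n p (e a) k * chartDeriv n p (e d) m *
        curvLower g p (extChartAt (𝓡 n) p p) i j k m,
      ← rot fun j k i => ∑ m, chartDeriv n p (e c) i * chartDeriv n p (e a) j *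
      chartDeriv n p (e b) k * chartDeriv n p (e d) m *
        curvLower g p (extChartAt (𝓡 n) p p) i j k m]
    simp only [← Finset.sum_add_distrib]
    refine Finset.sum_eq_zero fun i _ => Finset.sum_eq_zero fun j _ =>
      Finset.sum_eq_zero fun k _ => Finset.sum_eq_zero fun m _ => ?_
    linear_combination (chartDeriv n p (e a) i * chartDeriv n p (e b) j *
      chartDeriv n p (e c) k * chartDeriv n p (e d) m) * h.bianchi i j k m

variable {g p} {e : Fin n → TangentSpace (𝓡 n) p}

lemma IsOrthonormalFrame.inner_sum (he : IsOrthonormalFrame g p e) (c : Fin n → ℝ) (a : Fin n) :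
    g.inner p (∑ b, c b • e b) (e a) = c a := by
  simp only [map_sum, map_smul, sum_apply, smul_apply, smul_eq_mul, he _ _]
  simp

lemma IsOrthonormalFrame.linearIndependent (he : IsOrthonormalFrame g p e) :
    LinearIndependent ℝ e :=
  Fintype.linearIndependent_iff.mpr fun c hc a => by
    rw [← he.inner_sum c a, hc]
    simp

lemma IsOrthonormalFrame.trace_eq (he : IsOrthonormalFrame g p e)
    (f : TangentSpace (𝓡 n) p →ₗ[ℝ] TangentSpace (𝓡 n) p) :
    LinearMap.trace ℝ _ f = ∑ a, g.inner p (f (e a)) (e a) := by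
  have hcard : Fintype.card (Fin n) = Module.finrank ℝ (TangentSpace (𝓡 n) p) := by
    rw [Fintype.card_fin]
    exact (finrank_euclideanSpace_fin (𝕜 := ℝ) (n := n)).symm
  -- The basis construction below needs a nonempty index type.
  rcases Nat.eq_zero_or_pos n with rfl | hn
  · have : Subsingleton (TangentSpace (𝓡 0) p) :=
      inferInstanceAs (Subsingleton (EuclideanSpace ℝ (Fin 0)))
    have hf : f = 0 := Subsingleton.elim _ _
    simp [hf]
  have : Nonempty (Fin n) := ⟨⟨0, hn⟩⟩
  let b := basisOfLinearIndependentOfCardEqFinrank he.linearIndependent hcard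
  have hb : ∀ a, b a = e a := fun a => by simp [b]
  rw [LinearMap.trace_eq_matrix_trace ℝ b, Matrix.trace]
  refine Finset.sum_congr rfl fun a _ => ?_
  rw [Matrix.diag_apply, LinearMap.toMatrix_apply, hb]
  conv_rhs => rw [← b.sum_repr (f (e a))]
  simp only [hb]
  exact (he.inner_sum _ a).symm

lemma ricci_frame (he : IsOrthonormalFrame g p e) (i j : Fin n) :
    ricci g p (e i) (e j) = ∑ a, comp g p e a i j a :=
  he.trace_eq _

end Frames

/-! ### Einstein and super-Einstein metrics in dimension six -/

section Einstein

variable {M : Type*} [TopologicalSpace M] [ChartedSpace (EuclideanSpace ℝ (Fin 6)) M]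
    [IsManifold (𝓡 6) ∞ M] {g : Metric 6 M} {p : M} {e : Fin 6 → TangentSpace (𝓡 6) p}

lemma IsEinstein.isEinsteinWith (hg : IsEinstein g) (he : IsOrthonormalFrame g p e) :
    IsAlgCurv.IsEinsteinWith (comp g p e) (scalarCurv g p e / 6) := fun i j => by
  rw [← ricci_frame he, hg p e he, he i j]
  simp

lemma IsEinstein.curvature_identity (hg : IsEinstein g) (he : IsOrthonormalFrame g p e)
    (i j : Fin 6) :
    4 * scalarCurv g p e * tildeR (comp g p e) i j + 12 * checkR (comp g p e) i j
        + 12 * hatR (comp g p e) i j - 24 * ringR (comp g p e) i j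
      = (scalarCurv g p e * normSq (comp g p e) - 4 * ringScalar (comp g p e)
          + 2 * hatScalar (comp g p e)) * g.inner p (e i) (e j) := by
  have h := (isAlgCurv_comp g p e).einstein_identity (hg.isEinsteinWith he) i j
  rw [he i j]
  linear_combination h

lemma IsSuperEinstein.curvature_identity (hg : IsSuperEinstein g) (he : IsOrthonormalFrame g p e)
    (i j : Fin 6) :
    2 * ringR (comp g p e) i j - hatR (comp g p e) i j
      = (1 / 6) * (2 * ringScalar (comp g p e) - hatScalar (comp g p e))
          * g.inner p (e i) (e j) := by
  have hR := isAlgCurv_comp g p e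
  have hE := hg.1.isEinsteinWith he
  have h := hg.1.curvature_identity he i j
  obtain ⟨N, hN⟩ := hg.2
  obtain ⟨hN₁, hN₂⟩ := hN p e he
  have ht : ∀ u v, tildeR (comp g p e) u v = N / 6 * if u = v then 1 else 0 := fun u v => by
    have := hN₂ (e u) (e v)
    rw [he u v] at this
    exact_mod_cast this
  -- With `tildeR` proportional to the metric, `checkR` is a Ricci contraction. Then `4τ · N/6 + 12
  -- · Nτ/36 = τN` cancels the term `τ‖R‖²`, and dividing by -12 leaves the claim.
  have hc : checkR (comp g p e) i j = N / 6 * (scalarCurv g p e / 6) * if i = j then 1 else 0 := by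
    rw [hR.checkR_eq]
    have : ∀ u, ∑ v, comp g p e i u v j * tildeR (comp g p e) u v
        = N / 6 * comp g p e u i j u := fun u => by
      simp only [ht, mul_ite, mul_one, mul_zero, Finset.sum_ite_eq, Finset.mem_univ, if_true]
      rw [hR.skew_left i u, hR.skew_right u i]
      ring
    simp only [this, ← Finset.mul_sum, hE i j]
    split_ifs <;> ring
  rw [hc, ht, hN₁, he i j] at h
  rw [he i j]
  linear_combination (-1 / 12) * h

end Einstein

end RiemCurv

theorem theoremB {M : Type*} [TopologicalSpace M] [ChartedSpace (EuclideanSpace ℝ (Fin 6)) M]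
    [IsManifold (𝓡 6) ∞ M] (g : RiemCurv.Metric 6 M) :
    (RiemCurv.IsEinstein g →
      ∀ (p : M) (e : Fin 6 → TangentSpace (𝓡 6) p), RiemCurv.IsOrthonormalFrame g p e →
        ∀ i j : Fin 6,
          4 * RiemCurv.scalarCurv g p e * RiemCurv.tildeR (RiemCurv.comp g p e) i j
              + 12 * RiemCurv.checkR (RiemCurv.comp g p e) i j
              + 12 * RiemCurv.hatR (RiemCurv.comp g p e) i j
              - 24 * RiemCurv.ringR (RiemCurv.comp g p e) i j
            = (RiemCurv.scalarCurv g p e * RiemCurv.normSq (RiemCurv.comp g p e)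
                - 4 * RiemCurv.ringScalar (RiemCurv.comp g p e)
                + 2 * RiemCurv.hatScalar (RiemCurv.comp g p e)) * g.inner p (e i) (e j)) ∧
    (RiemCurv.IsSuperEinstein g →
      ∀ (p : M) (e : Fin 6 → TangentSpace (𝓡 6) p), RiemCurv.IsOrthonormalFrame g p e →
        ∀ i j : Fin 6,
          2 * RiemCurv.ringR (RiemCurv.comp g p e) i j - RiemCurv.hatR (RiemCurv.comp g p e) i j
            = (1 / 6) * (2 * RiemCurv.ringScalar (RiemCurv.comp g p e)
                - RiemCurv.hatScalar (RiemCurv.comp g p e)) * g.inner p (e i) (e j)) := by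
  exact ⟨fun hg p e he i j => hg.curvature_identity he i j,
    fun hg p e he i j => hg.curvature_identity he i j⟩
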